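/- Let $p>-1$ and let $J_p$ be the Laguerre operator in $\ell^2(\mathbb Z_+)$, $\mathbb Z_+=\{0,1,2,\dots\}$, that is, the closure of the Jacobi operator $$(J_pf)_n=a_{n-1}f_{n-1}+b_nf_n+a_nf_{n+1},\qquad a_{-1}=0,\quad a_n=\sqrt{(n+1)(n+1+p)},\quad b_n=2n+p+1,$$ defined on the sequences with finitely many non-zero components. There is exactly one strongly continuous one-parameter unitary group $e^{-iJ_pt}$, $t\in\mathbb R$, with generator $-iJ_p$. Let $L_n^{(p)}$ be the orthonormal (normalized Laguerre) polynomials defined by $L_{-1}^{(p)}=0$, $L_0^{(p)}=1$ and $a_{n-1}L^{(p)}_{n-1}(\lambda)+b_nL^{(p)}_n(\lambda)+a_nL^{(p)}_{n+1}(\lambda)=\lambda L^{(p)}_n(\lambda)$. Put $$\tau_p(\lambda)=\frac{\lambda^pe^{-\lambda}}{\Gamma(p+1)},\qquad \varphi^{(p)}_n(\lambda)=\sqrt{\tau_p(\lambda)}\,L^{(p)}_n(\lambda),\qquad \lambda\in\mathbb R_+=(0,\infty),$$ and let $\Phi_p:\ell^2(\mathbb Z_+)\to L^2(\mathbb R_+)$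 be the isometric operator $\Phi_pf=\sum_{n\ge0}f_n\varphi_n^{(p)}$ (the series converges in $L^2(\mathbb R_+)$). For $g\in C_0^\infty(\mathbb R_+)$ (smooth complex-valued functions with compact support in $(0,\infty)$) and $t\ne0$ set $$(U(t)g)_n=(-1)^ne^{in/t}|t|^{-1}g(n/t^2),\qquad n\in\mathbb Z_+.$$ If $f\in\ell^2(\mathbb Z_+)$ and $\Phi_pf\in C_0^\infty(\mathbb R_+)$, then $$\lim_{t\to\pm\infty}\big\|e^{-iJ_pt}f-e^{\mp i(p+1)\pi/2}\,U(t)\Phi_pf\big\|_{\ell^2(\mathbb Z_+)}=0$$ for both choices of the sign. -/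

import Mathlib

open MeasureTheory Filter Topology
open scoped ENNReal Distributions

namespace Laguerre

noncomputable section

/-- The complex Hilbert space `ℓ²(ℤ₊)`, `ℤ₊ = {0, 1, 2, …}`. -/
abbrev SeqSpace : Type := lp (fun _ : ℕ => ℂ) 2

/-- Lebesgue measure on `ℝ₊ = (0, ∞)`. -/
abbrev halfLine : Measure ℝ := volume.restrict (Set.Ioi 0)

/-- `ℝ₊ = (0, ∞)` as an open set. -/
def posReals : TopologicalSpace.Opens ℝ := ⟨Set.Ioi 0, isOpen_Ioi⟩

/-! ### Jacobi operators -/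

/-- The formal Jacobi matrix
`(J f)ₙ = aₙ₋₁ fₙ₋₁ + bₙ fₙ + aₙ fₙ₊₁`, with `a₋₁ = 0`, acting on arbitrary sequences. -/
def jacobiMatrix (a b : ℕ → ℝ) (f : ℕ → ℂ) : ℕ → ℂ
  | 0 => b 0 * f 0 + a 0 * f 1
  | n + 1 => a n * f n + b (n + 1) * f (n + 1) + a (n + 1) * f (n + 2)

/-- The set of vectors in `ℓ²` with finitely many non-zero components. -/
def finiteVectors : Submodule ℂ SeqSpace where
  carrier := {f | {n | f n ≠ 0}.Finite}
  zero_mem' := by simp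
  add_mem' := by
    intro f g hf hg
    refine (hf.union hg).subset fun n hn => ?_
    by_contra h
    simp only [Set.mem_union, Set.mem_ofPred_eq, not_or, not_not] at h
    exact hn (by simp [h.1, h.2])
  smul_mem' := by
    intro c f hf
    refine hf.subset fun n hn => ?_
    intro h
    exact hn (by simp [h])

theorem memlp_of_finite {f : ℕ → ℂ} (hf : {n | f n ≠ 0}.Finite) :
    Memℓp (E := fun _ : ℕ => ℂ) f 2 :=
  (memℓp_zero hf).of_exponent_ge (by simp)

theorem jacobiMatrix_finite (a b : ℕ → ℝ) {f : ℕ → ℂ} (hf : {n | f n ≠ 0}.Finite) :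
    {n | jacobiMatrix a b f n ≠ 0}.Finite := by
  obtain ⟨N, hN⟩ := hf.bddAbove
  have h0 : ∀ m, N < m → f m = 0 := fun m hm => by
    by_contra h
    exact absurd (hN h) (by omega)
  refine (Set.finite_Iic (N + 1)).subset fun n hn => ?_
  by_contra hlt
  simp only [Set.mem_Iic, not_le] at hlt
  obtain ⟨k, rfl⟩ : ∃ k, n = k + 1 := ⟨n - 1, by omega⟩
  exact hn (by
    simp [jacobiMatrix, h0 k (by omega), h0 (k + 1) (by omega), h0 (k + 2) (by omega)])

/-- The minimal Jacobi operator: the Jacobi matrix on vectors with finitely many non-zero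
components. -/
def minimalJacobi (a b : ℕ → ℝ) : SeqSpace →ₗ.[ℂ] SeqSpace where
  domain := finiteVectors
  toFun :=
    { toFun := fun f => ⟨jacobiMatrix a b f.1, memlp_of_finite (jacobiMatrix_finite a b f.2)⟩
      map_add' := by
        intro f g
        ext n
        change jacobiMatrix a b _ n = jacobiMatrix a b f.1 n + jacobiMatrix a b g.1 n
        cases n <;> simp [jacobiMatrix] <;> ring
      map_smul' := by
        intro c f
        ext n
        change jacobiMatrix a b _ n = c * jacobiMatrix a b f.1 n
        cases n <;> simp [jacobiMatrix] <;> ring }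

/-- The Jacobi operator in `ℓ²(ℤ₊)`: the closure of the minimal one. -/
def jacobiOperator (a b : ℕ → ℝ) : SeqSpace →ₗ.[ℂ] SeqSpace := (minimalJacobi a b).closure

/-- `aₙ = √((n + 1)(n + 1 + p))`. -/
def offDiag (p : ℝ) (n : ℕ) : ℝ := √((n + 1) * (n + 1 + p))

/-- `bₙ = 2 n + p + 1`. -/
def diag (p : ℝ) (n : ℕ) : ℝ := 2 * n + p + 1

/-- The Laguerre operator `J_p`. -/
def laguerreOperator (p : ℝ) : SeqSpace →ₗ.[ℂ] SeqSpace := jacobiOperator (offDiag p) (diag p)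

/-! ### The unitary group `e^{-iAt}` -/

/-- `V` is the strongly continuous one-parameter unitary group with generator `-iA`: the vectors
`f` at which `t ↦ V t f` is differentiable at `0` are those in the domain of `A`, and the
derivative is `-i A f`. -/
structure IsUnitaryGroup {H : Type*} [NormedAddCommGroup H] [InnerProductSpace ℂ H]
    (A : H →ₗ.[ℂ] H) (V : ℝ → (H ≃ₗᵢ[ℂ] H)) : Prop where
  map_zero : ∀ f, V 0 f = f
  map_add : ∀ s t f, V (s + t) f = V s (V t f)
  continuous : ∀ f, Continuous fun t => V t f
  generator : ∀ f g, (f, g) ∈ A.graph ↔ HasDerivAt (fun t => V t f) (-Complex.I • g) 0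

open Classical in
/-- The unitary group `t ↦ e^{-iAt}` of a self-adjoint operator `A`. (By Stone's theorem the group
exists if and only if the densely defined operator `A` is self-adjoint, and it is then unique; the
value for other `A` is a dummy.) -/
def unitaryGroup {H : Type*} [NormedAddCommGroup H] [InnerProductSpace ℂ H]
    (A : H →ₗ.[ℂ] H) : ℝ → (H ≃ₗᵢ[ℂ] H) :=
  if h : ∃ V, IsUnitaryGroup A V then h.choose else fun _ => LinearIsometryEquiv.refl ℂ H

/-! ### Laguerre polynomials and functions -/

/-- The orthonormal polynomials of the Jacobi matrix with coefficients `a`, `b`: `P₋₁ = 0`,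
`P₀ = 1`, `aₙ₋₁ Pₙ₋₁ + bₙ Pₙ + aₙ Pₙ₊₁ = X Pₙ`. -/
def orthoPoly (a b : ℕ → ℝ) : ℕ → Polynomial ℝ
  | 0 => 1
  | 1 => Polynomial.C (a 0)⁻¹ * (Polynomial.X - Polynomial.C (b 0))
  | n + 2 => Polynomial.C (a (n + 1))⁻¹ *
      ((Polynomial.X - Polynomial.C (b (n + 1))) * orthoPoly a b (n + 1)
        - Polynomial.C (a n) * orthoPoly a b n)

/-- The normalized Laguerre polynomials `Lₙ^{(p)}`. -/
def laguerrePoly (p : ℝ) (n : ℕ) : Polynomial ℝ := orthoPoly (offDiag p) (diag p) n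

/-- The density `τ_p(x) = x^p e^{-x} / Γ(p+1)` of the spectral measure, for `x > 0`. -/
def weight (p x : ℝ) : ℝ := (Real.Gamma (p + 1))⁻¹ * x ^ p * Real.exp (-x)

/-- `φₙ^{(p)} = √τ_p · Lₙ^{(p)}`, a function on `ℝ₊`. -/
def laguerreFun (p : ℝ) (n : ℕ) (x : ℝ) : ℝ := √(weight p x) * (laguerrePoly p n).eval x

/-! Orthonormality of the functions `φₙ^{(p)}` in `L²(ℝ₊)`. -/

theorem offDiag_pos {p : ℝ} (hp : -1 < p) (n : ℕ) : 0 < offDiag p n := by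
  have h : (0 : ℝ) ≤ n := n.cast_nonneg
  exact Real.sqrt_pos.2 (mul_pos (by linarith) (by linarith))

theorem weight_nonneg {p : ℝ} (hp : -1 < p) {x : ℝ} (hx : 0 < x) : 0 ≤ weight p x := by
  have := Real.Gamma_pos_of_pos (show 0 < p + 1 by linarith)
  unfold weight
  positivity

theorem laguerrePoly_zero (p : ℝ) : laguerrePoly p 0 = 1 := rfl

theorem rec_zero {p : ℝ} (hp : -1 < p) (x : ℝ) :
    x * (laguerrePoly p 0).eval x = diag p 0 * (laguerrePoly p 0).eval x
      + offDiag p 0 * (laguerrePoly p 1).eval x := by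
  have := (offDiag_pos hp 0).ne'
  simp only [laguerrePoly, orthoPoly, Polynomial.eval_mul, Polynomial.eval_sub, Polynomial.eval_C,
    Polynomial.eval_X, Polynomial.eval_one]
  field_simp
  ring

theorem rec_succ {p : ℝ} (hp : -1 < p) (n : ℕ) (x : ℝ) :
    x * (laguerrePoly p (n + 1)).eval x = offDiag p n * (laguerrePoly p n).eval x
      + diag p (n + 1) * (laguerrePoly p (n + 1)).eval x
      + offDiag p (n + 1) * (laguerrePoly p (n + 2)).eval x := by
  have := (offDiag_pos hp (n + 1)).ne'
  have h2 : (laguerrePoly p (n + 2)).eval x = (offDiag p (n + 1))⁻¹ *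
      ((x - diag p (n + 1)) * (laguerrePoly p (n + 1)).eval x
        - offDiag p n * (laguerrePoly p n).eval x) := by
    simp [laguerrePoly, orthoPoly]
  rw [h2]
  field_simp
  ring

theorem weight_mul_pow {p : ℝ} (k : ℕ) {x : ℝ} (hx : 0 < x) :
    x ^ k * weight p x = (Real.Gamma (p + 1))⁻¹ * (Real.exp (-x) * x ^ (p + 1 + k - 1)) := by
  rw [show p + 1 + (k : ℝ) - 1 = p + k by ring, Real.rpow_add hx, Real.rpow_natCast, weight]
  ring

theorem integrable_pow {p : ℝ} (hp : -1 < p) (k : ℕ) :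
    Integrable (fun x => x ^ k * weight p x) halfLine := by
  have hk : (0 : ℝ) ≤ k := k.cast_nonneg
  have h := (Real.GammaIntegral_convergent (show 0 < p + 1 + k by linarith)).const_mul
    (Real.Gamma (p + 1))⁻¹
  exact IntegrableOn.congr_fun h (fun x hx => (weight_mul_pow k hx).symm) measurableSet_Ioi

theorem integral_pow {p : ℝ} (hp : -1 < p) (k : ℕ) :
    ∫ x, x ^ k * weight p x ∂halfLine
      = (Real.Gamma (p + 1))⁻¹ * Real.Gamma (p + 1 + k) := by
  have hk : (0 : ℝ) ≤ k := k.cast_nonneg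
  rw [Real.Gamma_eq_integral (show 0 < p + 1 + k by linarith), ← integral_const_mul]
  exact setIntegral_congr_fun measurableSet_Ioi fun x hx => weight_mul_pow k hx

theorem integrable_poly {p : ℝ} (hp : -1 < p) (q : Polynomial ℝ) :
    Integrable (fun x => q.eval x * weight p x) halfLine := by
  induction q using Polynomial.induction_on' with
  | add q r hq hr =>
    simp only [Polynomial.eval_add, add_mul]
    exact hq.add hr
  | monomial n c => simpa [mul_assoc] using (integrable_pow hp n).const_mul c

/-- The functional `q ↦ ∫ q τ_p`. -/
def moment (p : ℝ) (q : Polynomial ℝ) : ℝ := ∫ x, q.eval x * weight p x ∂halfLine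

theorem moment_add {p : ℝ} (hp : -1 < p) (q r : Polynomial ℝ) :
    moment p (q + r) = moment p q + moment p r := by
  simp only [moment, Polynomial.eval_add, add_mul]
  exact integral_add (integrable_poly hp q) (integrable_poly hp r)

theorem moment_C_mul (p c : ℝ) (q : Polynomial ℝ) :
    moment p (Polynomial.C c * q) = c * moment p q := by
  simp only [moment, Polynomial.eval_mul, Polynomial.eval_C, mul_assoc]
  exact integral_const_mul _ _

open Polynomial in
theorem poly_rec_zero {p : ℝ} (hp : -1 < p) :
    X * laguerrePoly p 0 = C (diag p 0) * laguerrePoly p 0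
      + C (offDiag p 0) * laguerrePoly p 1 :=
  Polynomial.funext fun x => by simpa using rec_zero hp x

open Polynomial in
theorem poly_rec_succ {p : ℝ} (hp : -1 < p) (n : ℕ) :
    X * laguerrePoly p (n + 1) = C (offDiag p n) * laguerrePoly p n
      + C (diag p (n + 1)) * laguerrePoly p (n + 1)
      + C (offDiag p (n + 1)) * laguerrePoly p (n + 2) :=
  Polynomial.funext fun x => by simpa using rec_succ hp n x

/-- `(j)ₙ = j (j - 1) ⋯ (j - n + 1)` over `ℝ`. -/
def fallFact (j : ℝ) : ℕ → ℝ
  | 0 => 1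
  | n + 1 => (j - n) * fallFact j n

theorem fallFact_succ' (j : ℝ) (n : ℕ) : fallFact (j + 1) (n + 1) = (j + 1) * fallFact j n := by
  induction n with
  | zero => simp [fallFact]
  | succ n ih =>
    rw [fallFact, ih, fallFact]
    push_cast
    ring

theorem offDiag_sq {p : ℝ} (hp : -1 < p) (n : ℕ) :
    offDiag p n * offDiag p n = (n + 1) * (n + 1 + p) := by
  have h : (0 : ℝ) ≤ n := n.cast_nonneg
  exact Real.mul_self_sqrt (mul_nonneg (by linarith) (by linarith))

theorem moment_X_pow {p : ℝ} (hp : -1 < p) (j : ℕ) :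
    moment p (Polynomial.X ^ (j + 1)) = (p + 1 + j) * moment p (Polynomial.X ^ j) := by
  have hj : (0 : ℝ) ≤ j := j.cast_nonneg
  simp only [moment, Polynomial.eval_pow, Polynomial.eval_X, integral_pow hp]
  rw [show p + 1 + ((j + 1 : ℕ) : ℝ) = (p + 1 + j) + 1 by push_cast; ring,
    Real.Gamma_add_one (show p + 1 + (j : ℝ) ≠ 0 from (by linarith : 0 < p + 1 + (j : ℝ)).ne')]
  ring

open Polynomial in
theorem moment_aux {p : ℝ} (hp : -1 < p) (n : ℕ) :
    (∀ j : ℕ, (∏ k ∈ Finset.range n, offDiag p k) * moment p (X ^ j * laguerrePoly p n)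
        = fallFact j n * moment p (X ^ j)) ∧
    (∀ j : ℕ, (∏ k ∈ Finset.range (n + 1), offDiag p k) *
        moment p (X ^ j * laguerrePoly p (n + 1)) = fallFact j (n + 1) * moment p (X ^ j)) := by
  induction n with
  | zero =>
    have h0 : ∀ j : ℕ, moment p (X ^ j * laguerrePoly p 0) = moment p (X ^ j) := fun j => by
      rw [laguerrePoly_zero, mul_one]
    refine ⟨fun j => by simp [h0, fallFact], fun j => ?_⟩
    have h := congrArg (fun q => moment p (X ^ j * q)) (poly_rec_zero hp)
    simp only [mul_add] at h
    rw [moment_add hp, mul_left_comm (X ^ j) (C (diag p 0)), moment_C_mul,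
      mul_left_comm (X ^ j) (C (offDiag p 0)), moment_C_mul,
      ← mul_assoc, ← pow_succ, h0, h0, moment_X_pow hp] at h
    simp only [zero_add, Finset.prod_range_one, fallFact, Nat.cast_zero]
    simp only [diag, Nat.cast_zero] at h
    linarith
  | succ n ih =>
    obtain ⟨h0, h1⟩ := ih
    refine ⟨h1, fun j => ?_⟩
    have h := congrArg (fun q => moment p (X ^ j * q)) (poly_rec_succ hp n)
    simp only [mul_add] at h
    rw [moment_add hp, moment_add hp, mul_left_comm (X ^ j) (C (offDiag p n)),
      moment_C_mul, mul_left_comm (X ^ j) (C (diag p (n + 1))), moment_C_mul,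
      mul_left_comm (X ^ j) (C (offDiag p (n + 1))), moment_C_mul,
      ← mul_assoc, ← pow_succ] at h
    have e0 := h0 j
    have e1 := h1 j
    have e2 := h1 (j + 1)
    rw [moment_X_pow hp, Nat.cast_succ, fallFact_succ'] at e2
    rw [fallFact, fallFact]
    rw [fallFact] at e1
    have ha := offDiag_sq hp n
    rw [Finset.prod_range_succ] at e1 e2 ⊢
    rw [Finset.prod_range_succ]
    simp only [diag] at h
    push_cast at *
    linear_combination ((∏ k ∈ Finset.range n, offDiag p k) * offDiag p n) * (-h) + e2
      - (2 * ((n : ℝ) + 1) + p + 1) * e1 - offDiag p n * offDiag p n * e0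
      - fallFact j n * moment p (X ^ j) * ha

open Polynomial in
theorem moment_laguerrePoly {p : ℝ} (hp : -1 < p) (n : ℕ) :
    moment p (laguerrePoly p n) = if n = 0 then 1 else 0 := by
  have h := (moment_aux hp n).1 0
  have hpos : (∏ k ∈ Finset.range n, offDiag p k) ≠ 0 :=
    (Finset.prod_pos fun k _ => offDiag_pos hp k).ne'
  have h1 : moment p (X ^ 0) = 1 := by
    simp only [moment, eval_pow, eval_X, integral_pow hp, Nat.cast_zero, add_zero]
    exact inv_mul_cancel₀ (Real.Gamma_pos_of_pos (by linarith)).ne'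
  rw [h1, pow_zero, one_mul, mul_one] at h
  cases n with
  | zero => simpa [fallFact] using h
  | succ n =>
    have hz : fallFact ((0 : ℕ) : ℝ) (n + 1) = 0 := by
      clear h hpos
      induction n with
      | zero => simp [fallFact]
      | succ n ih => rw [fallFact, ih, mul_zero]
    rw [hz] at h
    simpa [hpos] using h

open Polynomial in
theorem moment_mul {p : ℝ} (hp : -1 < p) (m : ℕ) :
    (∀ n, moment p (laguerrePoly p m * laguerrePoly p n) = if m = n then 1 else 0) ∧
    (∀ n, moment p (laguerrePoly p (m + 1) * laguerrePoly p n) = if m + 1 = n then 1 else 0) := by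
  -- the two ways of moving the factor `X` in `∫ X Lₘ Lₙ τ`
  have right0 : ∀ m, moment p (X * laguerrePoly p m * laguerrePoly p 0)
      = diag p 0 * moment p (laguerrePoly p m * laguerrePoly p 0)
        + offDiag p 0 * moment p (laguerrePoly p m * laguerrePoly p 1) := fun m => by
    rw [← moment_C_mul, ← moment_C_mul, ← moment_add hp]
    congr 1
    linear_combination laguerrePoly p m * poly_rec_zero hp
  have right1 : ∀ m n, moment p (X * laguerrePoly p m * laguerrePoly p (n + 1))
      = offDiag p n * moment p (laguerrePoly p m * laguerrePoly p n)
        + diag p (n + 1) * moment p (laguerrePoly p m * laguerrePoly p (n + 1))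
        + offDiag p (n + 1) * moment p (laguerrePoly p m * laguerrePoly p (n + 2)) := fun m n => by
    rw [← moment_C_mul, ← moment_C_mul, ← moment_C_mul, ← moment_add hp, ← moment_add hp]
    congr 1
    linear_combination laguerrePoly p m * poly_rec_succ hp n
  have symm : ∀ m n, moment p (laguerrePoly p m * laguerrePoly p n)
      = moment p (laguerrePoly p n * laguerrePoly p m) := fun m n => by rw [mul_comm]
  have swap : ∀ m n, moment p (X * laguerrePoly p m * laguerrePoly p n)
      = moment p (X * laguerrePoly p n * laguerrePoly p m) := fun m n => by
    rw [mul_assoc, mul_assoc, mul_comm (laguerrePoly p m)]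
  have base : ∀ n, moment p (laguerrePoly p 0 * laguerrePoly p n) = if 0 = n then 1 else 0 :=
    fun n => by
      rw [laguerrePoly_zero, one_mul, moment_laguerrePoly hp]
      simp only [eq_comm]
  induction m with
  | zero =>
    refine ⟨base, fun n => ?_⟩
    have ha := (offDiag_pos hp 0).ne'
    have l := swap 0 n
    rw [right0 n, symm n 0, base n, symm n 1] at l
    rcases n with _ | n
    · rw [right0 0, base 0, base 1] at l
      norm_num at l
      simpa [ha] using l
    · rw [right1 0 n, base, base, base] at l
      rcases n with _ | n
      · simp at l ⊢
        have := mul_left_cancel₀ ha (l.symm.trans (mul_one _).symm)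
        simpa using this
      · simp at l ⊢
        rcases l with l | l
        · exact absurd l ha
        · exact l
  | succ m ih =>
    obtain ⟨h0, h1⟩ := ih
    refine ⟨h1, fun n => ?_⟩
    have ha := (offDiag_pos hp (m + 1)).ne'
    have l := swap (m + 1) n
    rw [right1 n m, symm n m, symm n (m + 1), symm n (m + 2), h0, h1] at l
    refine mul_left_cancel₀ ha ?_
    rcases n with _ | n
    · rw [right0 (m + 1), h1, h1] at l
      rcases m with _ | m <;> simp at l ⊢ <;> exact l
    · rw [right1 (m + 1) n, h1, h1, h1] at l
      split_ifs at l ⊢ <;> first | omega | skip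
      all_goals
        first
          | linarith
          | (have : n = m := by omega
             subst this
             linarith)
          | (have : n = m + 1 := by omega
             subst this
             linarith)
          | (have : m = n + 1 := by omega
             subst this
             linarith)

theorem laguerreFun_mul {p : ℝ} (hp : -1 < p) (m n : ℕ) {x : ℝ} (hx : 0 < x) :
    laguerreFun p m x * laguerreFun p n x
      = (laguerrePoly p m * laguerrePoly p n).eval x * weight p x := by
  rw [Polynomial.eval_mul]
  have := Real.mul_self_sqrt (weight_nonneg hp hx)
  unfold laguerreFun
  linear_combination (laguerrePoly p m).eval x * (laguerrePoly p n).eval x * this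

theorem measurable_laguerreFun (p : ℝ) (n : ℕ) : Measurable (laguerreFun p n) := by
  have : Measurable fun x => (laguerrePoly p n).eval x :=
    (laguerrePoly p n).continuous.measurable
  unfold laguerreFun weight
  fun_prop

theorem memLp_laguerreFun {p : ℝ} (hp : -1 < p) (n : ℕ) :
    MemLp (fun x => (laguerreFun p n x : ℂ)) 2 halfLine := by
  have hm := measurable_laguerreFun p n
  refine MemLp.ofReal ((memLp_two_iff_integrable_sq hm.aestronglyMeasurable).2 ?_)
  refine IntegrableOn.congr_fun (integrable_poly hp (laguerrePoly p n * laguerrePoly p n))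
    (fun x hx => ?_) measurableSet_Ioi
  simp only [pow_two]
  exact (laguerreFun_mul hp n n hx).symm

/-- `φₙ^{(p)}` as an element of `L²(ℝ₊)`. -/
def laguerreVec (p : ℝ) (hp : -1 < p) (n : ℕ) : Lp ℂ 2 halfLine := (memLp_laguerreFun hp n).toLp _

theorem orthonormal_laguerreVec (p : ℝ) (hp : -1 < p) : Orthonormal ℂ (laguerreVec p hp) := by
  rw [orthonormal_iff_ite]
  intro m n
  have h : inner ℂ (laguerreVec p hp m) (laguerreVec p hp n)
      = ∫ x, ((laguerreFun p m x * laguerreFun p n x : ℝ) : ℂ) ∂halfLine := by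
    rw [L2.inner_def]
    refine integral_congr_ae ?_
    filter_upwards [(memLp_laguerreFun hp m).coeFn_toLp, (memLp_laguerreFun hp n).coeFn_toLp]
      with x h1 h2
    rw [laguerreVec, laguerreVec, h1, h2]
    simp [mul_comm]
  rw [h, integral_complex_ofReal,
    setIntegral_congr_fun measurableSet_Ioi fun x hx => laguerreFun_mul hp m n hx]
  have := (moment_mul hp m).1 n
  rw [moment] at this
  rw [this]
  split_ifs <;> simp

/-- The operator `Φ_p : ℓ²(ℤ₊) → L²(ℝ₊)`, `Φ_p f = ∑ₙ fₙ φₙ^{(p)}`, where the series converges in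
`L²(ℝ₊)`. -/
def Phi (p : ℝ) (hp : -1 < p) : SeqSpace →ₗᵢ[ℂ] Lp ℂ 2 halfLine :=
  (orthonormal_laguerreVec p hp).orthogonalFamily.linearIsometry

theorem hasSum_Phi (p : ℝ) (hp : -1 < p) (f : SeqSpace) :
    HasSum (fun n => f n • laguerreVec p hp n) (Phi p hp f) := by
  have h := (orthonormal_laguerreVec p hp).orthogonalFamily.hasSum_linearIsometry f
  simp only [LinearIsometry.toSpanSingleton_apply] at h
  exact h

/-! ### The asymptotic evolution -/

/-- The sequence `(U(t) g)ₙ = (-1)ⁿ e^{in/t} |t|⁻¹ g(n / t²)`. -/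
def asympSeq (t : ℝ) (g : ℝ → ℂ) (n : ℕ) : ℂ :=
  (-1) ^ n * Complex.exp (Complex.I * ((n / t : ℝ) : ℂ)) * ((|t|⁻¹ : ℝ) : ℂ) * g (n / t ^ 2)

theorem asympSeq_finite (t : ℝ) (g : 𝓓(posReals, ℂ)) : {n | asympSeq t g n ≠ 0}.Finite := by
  rcases eq_or_ne t 0 with rfl | ht
  · simp [asympSeq]
  obtain ⟨M, hM⟩ := g.hasCompactSupport.isCompact.bddAbove
  refine (Set.finite_Iic ⌊M * t ^ 2⌋₊).subset fun n hn => ?_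
  have hg : g (n / t ^ 2) ≠ 0 := fun h => hn (by simp [asympSeq, h])
  have h := hM (subset_tsupport _ hg)
  exact Nat.le_floor ((div_le_iff₀ (by positivity)).1 h)

/-- `U(t) g ∈ ℓ²(ℤ₊)` for `g ∈ C₀^∞(ℝ₊)` (and `t ≠ 0`). -/
def asympEvolution (t : ℝ) (g : 𝓓(posReals, ℂ)) : SeqSpace :=
  ⟨asympSeq t g, memlp_of_finite (asympSeq_finite t g)⟩

end

end Laguerre

namespace Laguerre

noncomputable section

/-! ### Laplace transforms of powers -/

/-! Everything is tested on the coherent states `√τ_p(x) e^{-(s-1)x}`, `Re s > 1/2`. Their Laguerre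
coefficients are Laplace transforms and come out in closed form, `wₙ s^{-p-1} (1/s - 1)ⁿ`
(`pochMap_laguerrePoly`, `inner_laguerreVec_coherentVec`), while multiplication by `e^{-itx}` merely
replaces `s` by `s + it`. The binomial series shows that each such function has the same norm as its
coefficient sequence, so it lies in the range of `Φ_p` (`Phi_coherentState`); completeness of the
Laguerre functions is never needed. The states with real `s` are total in `ℓ²`, because their
pairings with a vector form a power series.

Hence multiplication by `e^{-itx}` preserves the range of `Φ_p`, and `V(t) = Φ_p⁻¹ e^{-itx} Φ_p` is
a unitary group. Its generator extends the minimal Jacobi operator by the three-term recurrence. The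
coherent states form a total set, invariant under `V` and inside the domain of the closure, so the
closure is the whole generator (`isUnitaryGroup_closure_of_core`), and the group is unique by
symmetry of the generator.

For the asymptotics, let `c` be the constant phase and `W(t) = V(t)⁻¹ c U(t) Φ_p f`. Norm
convergence of `W(t)` to `f` follows from `‖W(t)‖ → ‖f‖` and weak convergence. The first is a
Riemann sum with mesh `t⁻²`. For the second, a pairing with a coherent state of parameter `σ` equals
a pairing of `U(t) Φ_p f` with the explicit state of parameter `σ + it`. At `n ≈ x t²` the expansion
`log(1 - 1/(σ+it)) = i/t - (σ-1/2)/t² + o(t⁻²)` produces the factor `e^{in/t}` of `U(t)` and the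
damping of the limit function, `wₙ ~ n^{p/2}/√Γ(p+1)` produces the power in `√τ_p`, and
`(σ+it)^{-p-1}` produces `c`. The Riemann sums then converge by `tendsto_inv_sq_mul_tsum`. -/

theorem integrableOn_rpow_mul_exp_neg {a b : ℝ} (ha : 0 < a) (hb : 0 < b) :
    IntegrableOn (fun x : ℝ => x ^ (a - 1) * Real.exp (-(b * x))) (Set.Ioi 0) := by
  simpa using integrableOn_rpow_mul_exp_neg_mul_rpow (p := 1) (s := a - 1) (by linarith)
    one_pos hb

theorem integrableOn_rpow_mul_cexp_neg {a : ℝ} {s : ℂ} (ha : 0 < a) (hs : 0 < s.re) :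
    IntegrableOn (fun x : ℝ => ((x ^ (a - 1) : ℝ) : ℂ) * Complex.exp (-(s * x))) (Set.Ioi 0) := by
  refine (integrable_norm_iff ?_).1 ?_
  · exact (by fun_prop : Measurable fun x : ℝ =>
      ((x ^ (a - 1) : ℝ) : ℂ) * Complex.exp (-(s * x))).aestronglyMeasurable
  · refine (integrableOn_rpow_mul_exp_neg ha hs).congr_fun (fun x hx => ?_) measurableSet_Ioi
    have : 0 ≤ x ^ (a - 1) := Real.rpow_nonneg (le_of_lt hx) _
    simp [Complex.norm_exp, abs_of_nonneg this]

-- Analytic continuation from real `s`: the integral is the complex moment generating function, at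
-- `-s`, of the measure with density `x^(a-1)`, hence analytic on the half-plane, and the right side
-- is analytic there as well.
open ProbabilityTheory in
theorem integral_rpow_mul_cexp_neg {a : ℝ} {s : ℂ} (ha : 0 < a) (hs : 0 < s.re) :
    ∫ x in Set.Ioi (0 : ℝ), ((x ^ (a - 1) : ℝ) : ℂ) * Complex.exp (-(s * x))
      = (1 / s) ^ (a : ℂ) * Real.Gamma a := by
  set d : ℝ → NNReal := fun x => Real.toNNReal (x ^ (a - 1)) with hd
  have hdm : Measurable d := by fun_prop
  set μ : Measure ℝ := (volume.restrict (Set.Ioi (0 : ℝ))).withDensity (fun x => (d x : ℝ≥0∞))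
    with hμ
  have hmgf : ∀ z : ℂ, complexMGF id μ z
      = ∫ x in Set.Ioi (0 : ℝ), ((x ^ (a - 1) : ℝ) : ℂ) * Complex.exp (z * x) := by
    intro z
    rw [complexMGF, hμ, integral_withDensity_eq_integral_smul hdm]
    refine setIntegral_congr_fun measurableSet_Ioi fun x hx => ?_
    have : 0 ≤ x ^ (a - 1) := Real.rpow_nonneg (le_of_lt hx) _
    simp [hd, NNReal.smul_def, this]
  have hset : Set.Iio 0 ⊆ integrableExpSet id μ := by
    intro t ht
    rw [integrableExpSet, Set.mem_ofPred_eq, hμ, integrable_withDensity_iff_integrable_smul hdm]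
    have := integrableOn_rpow_mul_exp_neg ha (neg_pos.2 ht)
    refine this.congr_fun (fun x hx => ?_) measurableSet_Ioi
    have : 0 ≤ x ^ (a - 1) := Real.rpow_nonneg (le_of_lt hx) _
    simp [hd, NNReal.smul_def, this]
  have hint : Set.Iio 0 ⊆ interior (integrableExpSet id μ) := interior_maximal hset isOpen_Iio
  set D : Set ℂ := {z | z.re < 0} with hD
  have hDo : IsOpen D := isOpen_lt Complex.continuous_re continuous_const
  have h1 : AnalyticOnNhd ℂ (complexMGF id μ) D :=
    analyticOnNhd_complexMGF.mono fun z hz => hint hz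
  have h2 : AnalyticOnNhd ℂ (fun z : ℂ => (1 / (-z)) ^ (a : ℂ) * Real.Gamma a) D := by
    refine DifferentiableOn.analyticOnNhd (fun z hz => ?_) hDo
    have hz0 : z ≠ 0 := fun h => by simp [hD, h] at hz
    have hslit : 1 / (-z) ∈ Complex.slitPlane := by
      left
      rw [one_div, Complex.inv_re]
      refine div_pos (by simpa [hD] using hz) ?_
      exact Complex.normSq_pos.2 (neg_ne_zero.2 hz0)
    have : DifferentiableAt ℂ (fun z : ℂ => 1 / (-z)) z :=
      (differentiableAt_const _).div differentiableAt_id.neg (neg_ne_zero.2 hz0)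
    exact ((this.cpow_const hslit).mul_const _).differentiableWithinAt
  have hreal : ∀ t : ℝ, t < 0 → complexMGF id μ t = (1 / (-(t : ℂ))) ^ (a : ℂ) * Real.Gamma a := by
    intro t ht
    rw [hmgf]
    have h := Complex.integral_cpow_mul_exp_neg_mul_Ioi (a := a) (r := -t) (by simpa) (by linarith)
    rw [Complex.Gamma_ofReal] at h
    push_cast at h
    rw [← h]
    refine setIntegral_congr_fun measurableSet_Ioi fun x hx => ?_
    rw [Complex.ofReal_cpow (le_of_lt hx)]
    push_cast
    ring_nf
  have key : Set.EqOn (complexMGF id μ) (fun z : ℂ => (1 / (-z)) ^ (a : ℂ) * Real.Gamma a) D := by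
    refine h1.eqOn_of_preconnected_of_frequently_eq h2 ?_ (z₀ := ((-1 : ℝ) : ℂ)) (by simp [hD]) ?_
    · exact (convex_halfSpace_re_lt 0).isPreconnected
    · have h_real : ∃ᶠ (x : ℝ) in 𝓝[≠] (-1 : ℝ),
          complexMGF id μ x = (1 / (-(x : ℂ))) ^ (a : ℂ) * Real.Gamma a := by
        refine Eventually.frequently ?_
        filter_upwards [nhdsWithin_le_nhds (Iio_mem_nhds (show (-1 : ℝ) < 0 by norm_num))]
          with x hx using hreal x hx
      -- The identity theorem needs agreement at complex points accumulating at `-1`; a real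
      -- sequence, embedded in `ℂ`, provides them.
      rw [frequently_iff_seq_forall] at h_real ⊢
      obtain ⟨xs, hx_tendsto, hx_eq⟩ := h_real
      refine ⟨fun n => xs n, ?_, fun n => hx_eq n⟩
      rw [tendsto_nhdsWithin_iff] at hx_tendsto ⊢
      constructor
      · rw [tendsto_ofReal_iff]
        exact hx_tendsto.1
      · filter_upwards [hx_tendsto.2] with n hn h
        exact hn (Complex.ofReal_injective h)
  have := key (show -s ∈ D by simpa [hD] using hs)
  rw [hmgf] at this
  simpa using this

/-! ### The Laplace transform of the orthonormal polynomials -/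

open Polynomial in
/-- The linear map `X ^ k ↦ (p + 1)ₖ X ^ k`, the Laplace transform with respect to
`x ^ p / Γ(p + 1)` up to the factor `s ^ (-p-1)`, in the variable `1 / s`. -/
def pochMap (p : ℝ) : ℝ[X] →ₗ[ℝ] ℝ[X] :=
  Polynomial.lsum fun k => ((ascPochhammer ℝ k).eval (p + 1)) • Polynomial.monomial k

open Polynomial in
theorem pochMap_monomial (p : ℝ) (k : ℕ) (c : ℝ) :
    pochMap p (monomial k c) = monomial k ((ascPochhammer ℝ k).eval (p + 1) * c) := by
  simp [pochMap, Polynomial.lsum_apply, Polynomial.smul_monomial]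

-- Since `(p+1)ₖ₊₁ = (p+1)ₖ (p+1+k)`, multiplication by `X` turns into a first-order differential
-- operator; the summand `k` is what differentiation of `X ^ k` supplies.
open Polynomial in
theorem pochMap_X_mul (p : ℝ) (q : ℝ[X]) :
    pochMap p (X * q) = C (p + 1) * X * pochMap p q + X ^ 2 * derivative (pochMap p q) := by
  induction q using Polynomial.induction_on' with
  | add q r hq hr => simp only [mul_add, map_add, hq, hr]; ring
  | monomial n c =>
    rw [X_mul_monomial, pochMap_monomial, pochMap_monomial, derivative_monomial,
      ascPochhammer_succ_eval, mul_assoc (C (p + 1)), X_mul_monomial, C_mul_monomial]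
    rcases n with _ | n
    · simp
    · rw [X_pow_mul_monomial, Nat.succ_sub_one, ← map_add]
      congr 1
      push_cast
      ring

/-- `wₙ = √((p + 1)ₙ / n!)`. -/
def normCoeff (p : ℝ) (n : ℕ) : ℝ := ∏ k ∈ Finset.range n, offDiag p k / (k + 1)

theorem normCoeff_succ (p : ℝ) (n : ℕ) :
    normCoeff p (n + 1) = normCoeff p n * (offDiag p n / (n + 1)) := Finset.prod_range_succ _ _

theorem normCoeff_pos {p : ℝ} (hp : -1 < p) (n : ℕ) : 0 < normCoeff p n :=
  Finset.prod_pos fun k _ => div_pos (offDiag_pos hp k) (by positivity)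

/-- These two relations are what makes `wₙ (X - 1)ⁿ` solve the transformed three-term recurrence. -/
theorem normCoeff_recurrences {p : ℝ} (hp : -1 < p) (n : ℕ) :
    offDiag p n * normCoeff p (n + 1) = (p + 1 + n) * normCoeff p n ∧
      (n + 1) * normCoeff p (n + 1) = offDiag p n * normCoeff p n := by
  have h := offDiag_sq hp n
  have hn : (n : ℝ) + 1 ≠ 0 := by positivity
  rw [normCoeff_succ]
  constructor
  · field_simp
    linear_combination normCoeff p n * h
  · field_simp

-- Applying `pochMap` to the three-term recurrence gives a recurrence in which each polynomial is
-- determined by the two before it, and `wₙ (X - 1)ⁿ` satisfies it. Two consecutive indices are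
-- therefore carried through the induction.
open Polynomial in
theorem pochMap_laguerrePoly {p : ℝ} (hp : -1 < p) (n : ℕ) :
    pochMap p (laguerrePoly p n) = C (normCoeff p n) * (X - 1) ^ n ∧
      pochMap p (laguerrePoly p (n + 1)) = C (normCoeff p (n + 1)) * (X - 1) ^ (n + 1) := by
  have hC : ∀ (c : ℝ) (q : ℝ[X]), pochMap p (C c * q) = C c * pochMap p q := fun c q => by
    rw [← smul_eq_C_mul, map_smul, smul_eq_C_mul]
  have hd : ∀ m : ℕ, derivative ((X - 1 : ℝ[X]) ^ (m + 1)) = C ((m : ℝ) + 1) * (X - 1) ^ m := by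
    intro m
    simp [derivative_pow]
  induction n with
  | zero =>
    have h0 : pochMap p (laguerrePoly p 0) = 1 := by
      rw [laguerrePoly_zero, ← monomial_zero_one, pochMap_monomial]; simp
    refine ⟨by simpa [normCoeff] using h0, ?_⟩
    have h := congrArg (pochMap p) (poly_rec_zero hp)
    rw [pochMap_X_mul, map_add (pochMap p), hC, hC, h0] at h
    have ha := (offDiag_pos hp 0).ne'
    refine mul_left_cancel₀ (C_ne_zero.2 ha) ?_
    have hw := congrArg (C : ℝ → ℝ[X]) (normCoeff_recurrences hp 0).1
    simp only [normCoeff, Finset.range_zero, Finset.prod_empty, diag] at h hw ⊢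
    simp only [map_mul, map_add, map_one, derivative_one, Nat.cast_zero, map_zero] at h hw ⊢
    linear_combination -h - (X - 1) * hw
  | succ n ih =>
    obtain ⟨h0, h1⟩ := ih
    refine ⟨h1, ?_⟩
    have h := congrArg (pochMap p) (poly_rec_succ hp n)
    rw [pochMap_X_mul, map_add (pochMap p), map_add (pochMap p), hC, hC, hC, h0, h1,
      derivative_C_mul, hd] at h
    have ha := (offDiag_pos hp (n + 1)).ne'
    refine mul_left_cancel₀ (C_ne_zero.2 ha) ?_
    have hw := congrArg (C : ℝ → ℝ[X]) (normCoeff_recurrences hp (n + 1)).1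
    have hw' := congrArg (C : ℝ → ℝ[X]) (normCoeff_recurrences hp n).2
    simp only [diag] at h
    simp only [map_mul, map_add, map_one, Nat.cast_add, Nat.cast_one, map_natCast,
      map_ofNat] at h hw hw' ⊢
    linear_combination -h - (X - 1) ^ (n + 2) * hw + (X - 1) ^ n * hw'

/-- The weight already contains `e^{-x}`, so the integrand is a polynomial times `x^p
e^{-sx}/Γ(p+1)`, and monomials reduce to the Gamma integral. Integrability is proved along with the
value because additivity of the integral needs it. -/
theorem integrable_poly_mul_cexp {p : ℝ} (hp : -1 < p) {s : ℂ} (hs : 0 < s.re)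
    (q : Polynomial ℝ) :
    Integrable (fun x : ℝ => ((q.eval x * weight p x : ℝ) : ℂ) * Complex.exp (-((s - 1) * x)))
      halfLine ∧
    ∫ x, ((q.eval x * weight p x : ℝ) : ℂ) * Complex.exp (-((s - 1) * x)) ∂halfLine
      = (1 / s) ^ ((p + 1 : ℝ) : ℂ) * Polynomial.aeval (1 / s) (pochMap p q) := by
  have hs0 : s ≠ 0 := fun h => by simp [h] at hs
  induction q using Polynomial.induction_on' with
  | add q r hq hr =>
    simp only [Polynomial.eval_add, add_mul, Complex.ofReal_add (_ * _), map_add, mul_add]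
    exact ⟨hq.1.add hr.1, by rw [integral_add hq.1 hr.1, hq.2, hr.2]⟩
  | monomial n c =>
    have hn : (0 : ℝ) ≤ n := n.cast_nonneg
    have ha : 0 < p + 1 + n := by linarith
    have hG : Real.Gamma (p + 1) ≠ 0 := (Real.Gamma_pos_of_pos (by linarith)).ne'
    have hfun : ∀ x ∈ Set.Ioi (0 : ℝ),
        (((Polynomial.monomial n c).eval x * weight p x : ℝ) : ℂ) * Complex.exp (-((s - 1) * x))
        = ((c / Real.Gamma (p + 1) : ℝ) : ℂ)
          * (((x ^ (p + 1 + n - 1) : ℝ) : ℂ) * Complex.exp (-(s * x))) := by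
      intro x hx
      rw [Polynomial.eval_monomial, mul_assoc c, weight_mul_pow n hx,
        show -(s * x) = -((s - 1) * x) + ((-x : ℝ) : ℂ) by push_cast; ring, Complex.exp_add]
      push_cast
      ring
    refine ⟨IntegrableOn.congr_fun ((integrableOn_rpow_mul_cexp_neg ha hs).const_mul _)
      (fun x hx => (hfun x hx).symm) measurableSet_Ioi, ?_⟩
    rw [setIntegral_congr_fun measurableSet_Ioi hfun, integral_const_mul,
      integral_rpow_mul_cexp_neg ha hs, pochMap_monomial, Polynomial.aeval_monomial]
    have hGn : ∀ n : ℕ, Real.Gamma (p + 1 + n)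
        = (ascPochhammer ℝ n).eval (p + 1) * Real.Gamma (p + 1) := by
      intro n
      induction n with
      | zero => simp
      | succ n ih =>
        have hn : (0 : ℝ) ≤ n := n.cast_nonneg
        rw [Nat.cast_succ, ← add_assoc, Real.Gamma_add_one (by linarith), ih,
          ascPochhammer_succ_eval]
        ring
    rw [hGn, Complex.ofReal_add (p + 1), Complex.cpow_add _ _ (one_div_ne_zero hs0),
      Complex.ofReal_natCast, Complex.cpow_natCast]
    have hG' : (Real.Gamma (p + 1) : ℂ) ≠ 0 := Complex.ofReal_ne_zero.2 hG
    simp only [Complex.coe_algebraMap]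
    push_cast
    field_simp

/-! ### The coherent states -/

/-- `√τ_p(x) e^{-(s-1)x}`. -/
def coherentFun (p : ℝ) (s : ℂ) (x : ℝ) : ℂ :=
  ((√(weight p x) : ℝ) : ℂ) * Complex.exp (-((s - 1) * x))

theorem measurable_coherentFun (p : ℝ) (s : ℂ) : Measurable (coherentFun p s) := by
  unfold coherentFun weight
  fun_prop

theorem normSq_coherentFun {p : ℝ} (hp : -1 < p) (s : ℂ) {x : ℝ} (hx : 0 < x) :
    ‖coherentFun p s x‖ ^ 2 = (Real.Gamma (p + 1))⁻¹ *
      (x ^ (p + 1 - 1) * Real.exp (-((2 * s.re - 1) * x))) := by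
  rw [coherentFun, norm_mul, mul_pow, Complex.norm_real, Real.norm_eq_abs, sq_abs,
    Real.sq_sqrt (weight_nonneg hp hx), Complex.norm_exp, ← Real.exp_nat_mul, weight,
    mul_assoc, mul_assoc, ← Real.exp_add, add_sub_cancel_right]
  congr 3
  simp
  ring

theorem integrable_normSq_coherentFun {p : ℝ} (hp : -1 < p) {s : ℂ} (hs : 1 / 2 < s.re) :
    Integrable (fun x => ‖coherentFun p s x‖ ^ 2) halfLine :=
  IntegrableOn.congr_fun ((integrableOn_rpow_mul_exp_neg (show 0 < p + 1 by linarith)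
    (show 0 < 2 * s.re - 1 by linarith)).const_mul (Real.Gamma (p + 1))⁻¹)
    (fun _ hx => (normSq_coherentFun hp s hx).symm) measurableSet_Ioi

theorem integral_normSq_coherentFun {p : ℝ} (hp : -1 < p) {s : ℂ} (hs : 1 / 2 < s.re) :
    ∫ x, ‖coherentFun p s x‖ ^ 2 ∂halfLine = (1 / (2 * s.re - 1)) ^ (p + 1) := by
  rw [setIntegral_congr_fun measurableSet_Ioi fun _ hx => normSq_coherentFun hp s hx,
    integral_const_mul, Real.integral_rpow_mul_exp_neg_mul_Ioi (by linarith) (by linarith)]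
  have hG : Real.Gamma (p + 1) ≠ 0 := (Real.Gamma_pos_of_pos (by linarith)).ne'
  field_simp

theorem memLp_coherentFun {p : ℝ} (hp : -1 < p) {s : ℂ} (hs : 1 / 2 < s.re) :
    MemLp (coherentFun p s) 2 halfLine := by
  rw [memLp_two_iff_integrable_sq_norm (measurable_coherentFun p s).aestronglyMeasurable]
  exact integrable_normSq_coherentFun hp hs

/-- `√τ_p(x) e^{-(s-1)x}` as an element of `L²(ℝ₊)`. -/
def coherentVec (p : ℝ) (hp : -1 < p) {s : ℂ} (hs : 1 / 2 < s.re) : Lp ℂ 2 halfLine :=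
  (memLp_coherentFun hp hs).toLp _

theorem coeFn_coherentVec {p : ℝ} (hp : -1 < p) {s : ℂ} (hs : 1 / 2 < s.re) :
    coherentVec p hp hs =ᵐ[halfLine] coherentFun p s := (memLp_coherentFun hp hs).coeFn_toLp

theorem coeFn_laguerreVec {p : ℝ} (hp : -1 < p) (n : ℕ) :
    laguerreVec p hp n =ᵐ[halfLine] fun x => (laguerreFun p n x : ℂ) :=
  (memLp_laguerreFun hp n).coeFn_toLp

theorem norm_sq_eq_integral (F : Lp ℂ 2 halfLine) : ‖F‖ ^ 2 = ∫ x, ‖F x‖ ^ 2 ∂halfLine := by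
  have h := congrArg Complex.re (inner_self_eq_norm_sq_to_K (𝕜 := ℂ) F)
  rw [L2.inner_def] at h
  simp only [inner_self_eq_norm_sq_to_K] at h
  have h2 : ∀ x, ((‖F x‖ : ℝ) : ℂ) ^ 2 = ((‖F x‖ ^ 2 : ℝ) : ℂ) := fun x => by push_cast; rfl
  simp only [Complex.coe_algebraMap, h2, integral_complex_ofReal] at h
  have h3 : ((‖F‖ : ℝ) : ℂ) ^ 2 = ((‖F‖ ^ 2 : ℝ) : ℂ) := by push_cast; rfl
  rw [h3] at h
  exact_mod_cast h.symm

theorem norm_sq_coherentVec {p : ℝ} (hp : -1 < p) {s : ℂ} (hs : 1 / 2 < s.re) :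
    ‖coherentVec p hp hs‖ ^ 2 = (1 / (2 * s.re - 1)) ^ (p + 1) := by
  rw [norm_sq_eq_integral, ← integral_normSq_coherentFun hp hs]
  refine integral_congr_ae ?_
  filter_upwards [coeFn_coherentVec hp hs] with x hx
  rw [hx]

/-- The coefficients of `√τ_p(x) e^{-(s-1)x}` with respect to the functions `φₙ^{(p)}`. -/
def coherentSeq (p : ℝ) (s : ℂ) (n : ℕ) : ℂ :=
  (normCoeff p n : ℂ) * ((1 / s) ^ ((p + 1 : ℝ) : ℂ) * (1 / s - 1) ^ n)

theorem inner_laguerreVec_coherentVec {p : ℝ} (hp : -1 < p) {s : ℂ} (hs : 1 / 2 < s.re) (n : ℕ) :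
    inner ℂ (laguerreVec p hp n) (coherentVec p hp hs) = coherentSeq p s n := by
  have h := (integrable_poly_mul_cexp hp (s := s) (by linarith) (laguerrePoly p n)).2
  rw [(pochMap_laguerrePoly hp n).1] at h
  simp only [map_mul, map_pow, map_sub, Polynomial.aeval_C, Polynomial.aeval_X, map_one,
    Complex.coe_algebraMap] at h
  rw [coherentSeq, mul_left_comm, ← h, L2.inner_def]
  refine integral_congr_ae ?_
  filter_upwards [coeFn_coherentVec hp hs, coeFn_laguerreVec hp n,
    ae_restrict_mem measurableSet_Ioi] with x h1 h2 hx
  rw [h1, h2, coherentFun, laguerreFun]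
  simp only [RCLike.inner_apply, Complex.conj_ofReal]
  have hw : ((√(weight p x) : ℝ) : ℂ) * ((√(weight p x) : ℝ) : ℂ) = (weight p x : ℂ) := by
    rw [← Complex.ofReal_mul, Real.mul_self_sqrt (weight_nonneg hp hx)]
  push_cast
  linear_combination (((laguerrePoly p n).eval x : ℝ) : ℂ) * Complex.exp (-((s - 1) * x)) * hw

/-! ### Norms of the coherent states through the binomial series. -/

theorem factorial_mul_normCoeff_sq {p : ℝ} (hp : -1 < p) (n : ℕ) :
    (n.factorial : ℝ) * normCoeff p n ^ 2 = ∏ j ∈ Finset.range n, (p + 1 + j) := by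
  induction n with
  | zero => simp [normCoeff]
  | succ n ih =>
    rw [Finset.prod_range_succ, ← ih, Nat.factorial_succ]
    have h := normCoeff_recurrences hp n
    push_cast
    have h1 : ((n : ℝ) + 1) * normCoeff p (n + 1) ^ 2 = (p + 1 + n) * normCoeff p n ^ 2 := by
      linear_combination normCoeff p (n + 1) * h.2 + normCoeff p n * h.1
    linear_combination (n.factorial : ℝ) * h1

theorem normCoeff_sq {p : ℝ} (hp : -1 < p) (n : ℕ) :
    normCoeff p n ^ 2 = Ring.choose (p + 1 + n - 1) n := by
  have h := Ring.factorial_nsmul_multichoose_eq_ascPochhammer (p + 1) n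
  have hprod : (ascPochhammer ℝ n).eval (p + 1) = ∏ j ∈ Finset.range n, (p + 1 + j) := by
    clear h
    induction n with
    | zero => simp
    | succ n ih => rw [ascPochhammer_succ_eval, Finset.prod_range_succ, ih]
  rw [Polynomial.ascPochhammer_smeval_eq_eval, hprod, nsmul_eq_mul,
    ← factorial_mul_normCoeff_sq hp] at h
  rw [← Ring.multichoose_eq]
  exact (mul_left_cancel₀ (by positivity) h).symm

theorem hasSum_normCoeff_sq {p : ℝ} (hp : -1 < p) {x : ℝ} (hx : |x| < 1) :
    HasSum (fun n => normCoeff p n ^ 2 * x ^ n) (1 / (1 - x) ^ (p + 1)) := by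
  have h := (Real.one_div_one_sub_rpow_hasFPowerSeriesOnBall_zero (p + 1)).hasSum (y := x)
    (by simpa [enorm_eq_nnnorm, ← NNReal.coe_lt_coe] using hx)
  simp only [zero_add] at h
  refine h.congr_fun fun n => ?_
  rw [FormalMultilinearSeries.ofScalars_apply_eq, normCoeff_sq hp, smul_eq_mul]

/-- Quantitative form of the fact that `s ↦ 1/s - 1` maps the half-plane `Re s > 1/2` into the unit
disc. -/
theorem norm_one_div_sub_one_sq {s : ℂ} (hs : 1 / 2 < s.re) :
    ‖1 / s - 1‖ ^ 2 = 1 - (2 * s.re - 1) * ‖1 / s‖ ^ 2 := by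
  have hs0 : s ≠ 0 := fun h => by norm_num [h] at hs
  have hn : Complex.normSq s ≠ 0 := by simpa using hs0
  rw [show 1 / s - 1 = (1 - s) / s by field_simp, norm_div, norm_div, div_pow, div_pow,
    ← Complex.normSq_eq_norm_sq, ← Complex.normSq_eq_norm_sq]
  field_simp
  rw [Complex.normSq_apply, Complex.normSq_apply]
  simp
  ring

theorem norm_one_div_sub_one_lt {s : ℂ} (hs : 1 / 2 < s.re) : ‖1 / s - 1‖ < 1 := by
  have hs0 : s ≠ 0 := fun h => by norm_num [h] at hs
  have h := norm_one_div_sub_one_sq hs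
  have : 0 < ‖1 / s‖ := norm_pos_iff.2 (one_div_ne_zero hs0)
  have : 0 < (2 * s.re - 1) * ‖1 / s‖ ^ 2 := mul_pos (by linarith) (by positivity)
  nlinarith [norm_nonneg (1 / s - 1)]

/-- The binomial series at `‖1/s - 1‖²`: its sum contains `(1 - ‖1/s - 1‖²)^{-(p+1)}`, where the
factor `‖1/s‖²` cancels against the prefactor. The value is also the squared `L²` norm of the
corresponding function. -/
theorem hasSum_normSq_coherentSeq {p : ℝ} (hp : -1 < p) {s : ℂ} (hs : 1 / 2 < s.re) :
    HasSum (fun n => ‖coherentSeq p s n‖ ^ 2) ((1 / (2 * s.re - 1)) ^ (p + 1)) := by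
  have hs0 : s ≠ 0 := fun h => by norm_num [h] at hs
  have hpos : 0 < ‖1 / s‖ := norm_pos_iff.2 (one_div_ne_zero hs0)
  have hq : |‖1 / s - 1‖ ^ 2| < 1 := by
    rw [abs_of_nonneg (by positivity)]
    nlinarith [norm_one_div_sub_one_lt hs, norm_nonneg (1 / s - 1)]
  have h := (hasSum_normCoeff_sq hp hq).mul_left ((‖1 / s‖ ^ (p + 1)) ^ 2)
  have e1 : (fun n => ‖coherentSeq p s n‖ ^ 2)
      = fun n => (‖1 / s‖ ^ (p + 1)) ^ 2 * (normCoeff p n ^ 2 * (‖1 / s - 1‖ ^ 2) ^ n) := by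
    ext n
    rw [coherentSeq, norm_mul, norm_mul, norm_pow, Complex.norm_cpow_real, Complex.norm_real,
      Real.norm_eq_abs, mul_pow, sq_abs]
    ring
  have e2 : (1 / (2 * s.re - 1)) ^ (p + 1)
      = (‖1 / s‖ ^ (p + 1)) ^ 2 * (1 / (1 - ‖1 / s - 1‖ ^ 2) ^ (p + 1)) := by
    have h1 : 0 < 2 * s.re - 1 := by linarith
    rw [norm_one_div_sub_one_sq hs, sub_sub_cancel, Real.mul_rpow h1.le (by positivity),
      ← Real.rpow_natCast, ← Real.rpow_natCast, ← Real.rpow_mul hpos.le, ← Real.rpow_mul hpos.le,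
      mul_comm (p + 1), Real.div_rpow zero_le_one h1.le, Real.one_rpow]
    have h2 : 0 < ‖1 / s‖ ^ (((2 : ℕ) : ℝ) * (p + 1)) := Real.rpow_pos_of_pos hpos _
    have h3 : 0 < (2 * s.re - 1) ^ (p + 1) := Real.rpow_pos_of_pos h1 _
    field_simp
  rw [e1, e2]
  exact h

/-- The coherent state `s` in `ℓ²(ℤ₊)`. -/
def coherentState (p : ℝ) (hp : -1 < p) {s : ℂ} (hs : 1 / 2 < s.re) : SeqSpace :=
  ⟨coherentSeq p s, memℓp_gen (by simpa using (hasSum_normSq_coherentSeq hp hs).summable)⟩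

theorem coherentState_apply {p : ℝ} (hp : -1 < p) {s : ℂ} (hs : 1 / 2 < s.re) (n : ℕ) :
    coherentState p hp hs n = coherentSeq p s n := rfl

theorem norm_sq_coherentState {p : ℝ} (hp : -1 < p) {s : ℂ} (hs : 1 / 2 < s.re) :
    ‖coherentState p hp hs‖ ^ 2 = (1 / (2 * s.re - 1)) ^ (p + 1) := by
  have h := lp.hasSum_norm (p := 2) (by simp) (coherentState p hp hs)
  simp only [ENNReal.toReal_ofNat, Real.rpow_two] at h
  exact h.unique (hasSum_normSq_coherentSeq hp hs)

/-- Equality in Bessel's inequality: `v` and `Φ_p u` have equal norms and `⟨v, Φ_p u⟩ = ‖u‖²`, so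
expanding `‖Φ_p u - v‖²` gives zero. This puts the function in the range of `Φ_p` without
completeness of the Laguerre system. -/
theorem Phi_coherentState {p : ℝ} (hp : -1 < p) {s : ℂ} (hs : 1 / 2 < s.re) :
    Phi p hp (coherentState p hp hs) = coherentVec p hp hs := by
  have h1 : inner ℂ (coherentVec p hp hs) (Phi p hp (coherentState p hp hs))
      = inner ℂ (coherentState p hp hs) (coherentState p hp hs) := by
    have h := (hasSum_Phi p hp (coherentState p hp hs)).mapL
      (innerSL ℂ (coherentVec p hp hs))
    have h' := lp.hasSum_inner (𝕜 := ℂ) (coherentState p hp hs) (coherentState p hp hs)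
    refine h.unique (h'.congr_fun fun n => ?_)
    rw [innerSL_apply_apply, inner_smul_right, ← inner_conj_symm,
      inner_laguerreVec_coherentVec hp hs, coherentState_apply, RCLike.inner_apply]
  rw [← sub_eq_zero, ← norm_eq_zero, ← sq_eq_zero_iff, norm_sub_rev,
    @norm_sub_sq ℂ, h1, LinearIsometry.norm_map, norm_sq_coherentState, norm_sq_coherentVec,
    inner_self_eq_norm_sq, norm_sq_coherentState]
  ring

/-- The coherent states with real parameter are total in `ℓ²(ℤ₊)`. -/
theorem eq_zero_of_inner_coherentState {p : ℝ} (hp : -1 < p) (u : SeqSpace)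
    (h : ∀ (s : ℝ) (hs : 1 / 2 < (s : ℂ).re), inner ℂ u (coherentState p hp hs) = 0) : u = 0 := by
  -- For `s = 1/(1+q)` with `|q| < 1`, the pairing is `(1+q)^{p+1} ∑ cₙ qⁿ`. The power series
  -- vanishes near zero, so all its coefficients do.
  set c : ℕ → ℂ := fun n => (normCoeff p n : ℂ) * (starRingEnd ℂ) (u n) with hc
  have hsum : ∀ q : ℝ, |q| < 1 → HasSum (fun n => (q : ℂ) ^ n * c n) 0 := by
    intro q hq
    obtain ⟨hq1, hq2⟩ := abs_lt.1 hq
    have hq0 : 0 < q + 1 := by linarith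
    have hs : 1 / 2 < (((q + 1)⁻¹ : ℝ) : ℂ).re := by
      rw [Complex.ofReal_re, one_div, inv_lt_inv₀ two_pos hq0]
      linarith
    have h1 := lp.hasSum_inner (𝕜 := ℂ) u (coherentState p hp hs)
    rw [h] at h1
    have hA : (((q + 1 : ℝ) : ℂ)) ^ ((p + 1 : ℝ) : ℂ) ≠ 0 := by
      rw [Complex.cpow_ne_zero_iff]
      exact Or.inl (Complex.ofReal_ne_zero.2 hq0.ne')
    have h2 := h1.mul_left ((((q + 1 : ℝ) : ℂ)) ^ ((p + 1 : ℝ) : ℂ))⁻¹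
    rw [mul_zero] at h2
    refine h2.congr_fun fun n => ?_
    rw [coherentState_apply, coherentSeq]
    have hu : 1 / (((q + 1)⁻¹ : ℝ) : ℂ) = ((q + 1 : ℝ) : ℂ) := by push_cast; simp
    rw [hu, RCLike.inner_apply, hc]
    field_simp
    push_cast
    ring
  set P : FormalMultilinearSeries ℝ ℝ ℂ :=
    fun n => ContinuousMultilinearMap.mkPiRing ℝ (Fin n) (c n) with hP
  have hPc : ∀ n, P.coeff n = c n := fun n => by
    simp [hP, FormalMultilinearSeries.coeff]
  have hps : HasFPowerSeriesAt (0 : ℝ → ℂ) P 0 := by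
    rw [hasFPowerSeriesAt_iff]
    filter_upwards [Metric.ball_mem_nhds (0 : ℝ) one_pos] with q hq
    refine (hsum q (by simpa using hq)).congr_fun fun n => ?_
    rw [hPc, Complex.real_smul]
    push_cast
    rfl
  have hP0 := hps.eq_zero
  ext n
  have h0 : c n = 0 := by rw [← hPc, hP0]; simp [FormalMultilinearSeries.coeff]
  simpa [hc, (normCoeff_pos hp n).ne'] using h0

/-! ### One-parameter unitary groups and their generators -/

section UnitaryGroup

variable {H : Type*} [NormedAddCommGroup H] [InnerProductSpace ℂ H]

theorem hasDerivAt_group {V : ℝ → (H ≃ₗᵢ[ℂ] H)}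
    (hadd : ∀ s t f, V (s + t) f = V s (V t f)) {f g : H}
    (h : HasDerivAt (fun t => V t f) g 0) (t : ℝ) : HasDerivAt (fun t => V t f) (V t g) t := by
  have h1 : HasDerivAt (fun s => V (s - t) f) g t := by
    have : HasDerivAt (fun t => V t f) g (t - t) := by rwa [sub_self]
    simpa using this.comp_sub_const t t
  have h2 := ((V t).toContinuousLinearEquiv.toContinuousLinearMap.restrictScalars ℝ
    ).hasFDerivAt.comp_hasDerivAt t h1
  refine h2.congr_of_eventuallyEq (Eventually.of_forall fun s => ?_)
  simp only [Function.comp_apply, ContinuousLinearMap.coe_restrictScalars',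
    ContinuousLinearEquiv.coe_coe, LinearIsometryEquiv.coe_toContinuousLinearEquiv]
  rw [← hadd, add_sub_cancel]

/-- The graph of the operator `A` with generator `-iA` of the group `V`. -/
def generatorGraph (V : ℝ → (H ≃ₗᵢ[ℂ] H)) : Submodule ℂ (H × H) where
  carrier := {x | HasDerivAt (fun t => V t x.1) (-Complex.I • x.2) 0}
  zero_mem' := by simpa using hasDerivAt_const (0 : ℝ) (0 : H)
  add_mem' := by
    intro x y hx hy
    rw [Set.mem_ofPred_eq] at hx hy
    simpa [Pi.add_def, add_comm] using HasDerivAt.add hx hy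
  smul_mem' := by
    intro c x hx
    rw [Set.mem_ofPred_eq] at hx
    have h := HasDerivAt.const_smul c hx
    rw [smul_comm] at h
    simpa [Pi.smul_def] using h

theorem mem_generatorGraph {V : ℝ → (H ≃ₗᵢ[ℂ] H)} {x : H × H} :
    x ∈ generatorGraph V ↔ HasDerivAt (fun t => V t x.1) (-Complex.I • x.2) 0 := Iff.rfl

/-- The derivative along the orbit of `f` is `V t (-i g)`; since `V t` is isometric, convergence of
the vectors `g` makes these derivatives converge uniformly in `t`, and differentiation passes to the
limit. -/
theorem isClosed_generatorGraph {V : ℝ → (H ≃ₗᵢ[ℂ] H)} (h0 : ∀ f, V 0 f = f)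
    (hadd : ∀ s t f, V (s + t) f = V s (V t f)) :
    IsClosed (generatorGraph V : Set (H × H)) := by
  refine isSeqClosed_iff_isClosed.1 fun x y hx hy => ?_
  have h1 := (continuous_fst.tendsto y).comp hy
  have h2 := (continuous_snd.tendsto y).comp hy
  have key := hasDerivAt_of_tendstoUniformly (𝕜 := ℝ) (l := atTop)
    (f := fun n t => V t (x n).1) (g := fun t => V t y.1)
    (f' := fun n t => V t (-Complex.I • (x n).2)) (g' := fun t => V t (-Complex.I • y.2))
    ?_ (Eventually.of_forall fun n t => hasDerivAt_group hadd (hx n) t)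
    (fun t => ((V t).continuous.tendsto _).comp h1) 0
  · rw [h0] at key
    exact key
  · rw [Metric.tendstoUniformly_iff]
    intro ε hε
    filter_upwards [Metric.tendsto_nhds.1 h2 ε hε] with n hn t
    rw [(V t).dist_map, dist_comm, dist_smul₀]
    simpa using hn

/-- Symmetry of the generator: differentiate the constant `⟨V t x, V t y⟩` at zero. -/
theorem inner_generatorGraph_comm {V : ℝ → (H ≃ₗᵢ[ℂ] H)} (h0 : ∀ f, V 0 f = f) {x y : H × H}
    (hx : x ∈ generatorGraph V) (hy : y ∈ generatorGraph V) :
    inner ℂ x.2 y.1 = inner ℂ x.1 y.2 := by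
  have h := HasDerivAt.inner ℂ (mem_generatorGraph.1 hx) (mem_generatorGraph.1 hy)
  simp only [LinearIsometryEquiv.inner_map_map, h0] at h
  have h' := h.unique (hasDerivAt_const (0 : ℝ) (inner ℂ x.1 y.1))
  rw [inner_smul_left, inner_smul_right] at h'
  simp only [map_neg, Complex.conj_I, neg_neg] at h'
  have : Complex.I * (inner ℂ x.2 y.1 - inner ℂ x.1 y.2) = 0 := by linear_combination h'
  simpa [sub_eq_zero] using this

theorem IsUnitaryGroup.mem_graph_apply {A : H →ₗ.[ℂ] H} {V : ℝ → (H ≃ₗᵢ[ℂ] H)}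
    (hV : IsUnitaryGroup A V) {f g : H} (h : (f, g) ∈ A.graph) (t : ℝ) :
    (V t f, V t g) ∈ A.graph := by
  rw [hV.generator] at h ⊢
  have h1 := hasDerivAt_group hV.map_add h t
  have h2 : HasDerivAt (fun s => V (s + t) f) (V t (-Complex.I • g)) 0 := by
    have : HasDerivAt (fun t => V t f) (V t (-Complex.I • g)) (0 + t) := by rwa [zero_add]
    simpa using this.comp_add_const 0 t
  rw [map_smul] at h2
  simpa only [hV.map_add] using h2

/-- On the domain, `⟨V t g, W t f⟩` has zero derivative because both groups preserve the graph of
the symmetric operator `A`. Density then forces `V t = W t`. -/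
theorem IsUnitaryGroup.unique {A : H →ₗ.[ℂ] H} {V W : ℝ → (H ≃ₗᵢ[ℂ] H)}
    (hA : Dense (A.domain : Set H)) (hV : IsUnitaryGroup A V) (hW : IsUnitaryGroup A W) :
    V = W := by
  have hdom : ∀ f ∈ A.domain, ∃ g, (f, g) ∈ A.graph := fun f hf =>
    ⟨A ⟨f, hf⟩, A.mem_graph ⟨f, hf⟩⟩
  have key : ∀ f ∈ A.domain, ∀ g ∈ A.domain, ∀ t, inner ℂ (V t g) (W t f) = inner ℂ g f := by
    intro f hf g hg t
    obtain ⟨f', hf'⟩ := hdom f hf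
    obtain ⟨g', hg'⟩ := hdom g hg
    have hd : ∀ s, HasDerivAt (fun s => inner ℂ (V s g) (W s f)) 0 s := by
      intro s
      have h := HasDerivAt.inner ℂ
        (hasDerivAt_group hV.map_add ((hV.generator g g').1 hg') s)
        (hasDerivAt_group hW.map_add ((hW.generator f f').1 hf') s)
      have hs := inner_generatorGraph_comm (V := V) hV.map_zero
        (x := (V s g, V s g')) (y := (W s f, W s f'))
        ((hV.generator _ _).1 (hV.mem_graph_apply hg' s))
        ((hV.generator _ _).1 (hW.mem_graph_apply hf' s))
      simp only [map_smul, inner_smul_left, inner_smul_right, map_neg, Complex.conj_I] at hs h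
      rw [hs, neg_neg, neg_mul, neg_add_cancel] at h
      exact h
    have hc := is_const_of_deriv_eq_zero (fun s => (hd s).differentiableAt)
      (fun s => (hd s).deriv) t 0
    simpa [hV.map_zero, hW.map_zero] using hc
  funext t
  have hfun : ∀ f ∈ A.domain, V t f = W t f := by
    intro f hf
    rw [← (V t).symm.injective.eq_iff, LinearIsometryEquiv.symm_apply_apply]
    refine hA.eq_of_inner_right (𝕜 := ℂ) fun g hg => ?_
    rw [← (V t).inner_map_map g ((V t).symm (W t f)), LinearIsometryEquiv.apply_symm_apply,
      key f hf g hg]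
  refine LinearIsometryEquiv.ext fun f => ?_
  exact congrFun (Continuous.ext_on hA (V t).continuous (W t).continuous hfun) f

/-- If the generator of a unitary group extends `T` and `T + i` has dense range, then the group is
generated by the closure of `T`. -/
theorem isUnitaryGroup_closure [CompleteSpace H] {T : H →ₗ.[ℂ] H} {V : ℝ → (H ≃ₗᵢ[ℂ] H)}
    (h0 : ∀ f, V 0 f = f) (hadd : ∀ s t f, V (s + t) f = V s (V t f))
    (hcont : ∀ f, Continuous fun t => V t f) (hT : T.graph ≤ generatorGraph V)
    (hrange : ∀ u : H, (∀ x ∈ T.graph, inner ℂ u (x.2 + Complex.I • x.1) = 0) → u = 0) :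
    T.IsClosable ∧ IsUnitaryGroup T.closure V := by
  have hG : T.graph.topologicalClosure ≤ generatorGraph V :=
    Submodule.topologicalClosure_minimal _ hT (isClosed_generatorGraph h0 hadd)
  have hclos : T.IsClosable := by
    refine ⟨T.graph.topologicalClosure.toLinearPMap, ?_⟩
    rw [Submodule.toLinearPMap_graph_eq]
    intro x hx hx0
    have h := mem_generatorGraph.1 (hG hx)
    simp only [hx0, map_zero] at h
    have := h.unique (hasDerivAt_const (0 : ℝ) (0 : H))
    simpa using this
  refine ⟨hclos, h0, hadd, hcont, fun f g => ?_⟩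
  rw [← hclos.graph_closure_eq_closure_graph]
  refine ⟨fun h => mem_generatorGraph.1 (hG h), fun h => ?_⟩
  -- For a symmetric operator the cross term in `‖Ax + ix‖²` has zero real part, leaving `‖Ax‖² +
  -- ‖x‖²`. So `A + i` is bounded below on the graph, hence injective, with closed range on closed
  -- subspaces.
  have hnorm : ∀ x ∈ generatorGraph V, ‖x‖ ≤ ‖x.2 + Complex.I • x.1‖ := by
    intro x hx
    have hs := inner_generatorGraph_comm h0 hx hx
    have hre : RCLike.re (inner ℂ x.2 (Complex.I • x.1)) = 0 := by
      have h1 : (inner ℂ x.2 x.1 : ℂ).im = 0 := by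
        have h2 := inner_conj_symm (𝕜 := ℂ) x.2 x.1
        rw [← hs] at h2
        exact Complex.conj_eq_iff_im.1 h2
      rw [inner_smul_right]
      simp [h1]
    have h2 := norm_add_sq (𝕜 := ℂ) x.2 (Complex.I • x.1)
    rw [hre, norm_smul, Complex.norm_I, one_mul, mul_zero, add_zero] at h2
    rw [Prod.norm_def]
    refine max_le ?_ ?_
    · exact (sq_le_sq₀ (norm_nonneg _) (norm_nonneg _)).1 (by rw [h2]; nlinarith [sq_nonneg ‖x.2‖])
    · exact (sq_le_sq₀ (norm_nonneg _) (norm_nonneg _)).1 (by rw [h2]; nlinarith [sq_nonneg ‖x.1‖])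
  set S : (H × H) →L[ℂ] H :=
    ContinuousLinearMap.snd ℂ H H + Complex.I • ContinuousLinearMap.fst ℂ H H with hS
  have hSa : ∀ x, S x = x.2 + Complex.I • x.1 := fun x => rfl
  set S' : T.graph.topologicalClosure →L[ℂ] H :=
    S.comp T.graph.topologicalClosure.subtypeL with hS'
  have hcl : IsClosed (Set.range S') := by
    have : CompleteSpace T.graph.topologicalClosure :=
      T.graph.isClosed_topologicalClosure.completeSpace_coe
    have hanti : AntilipschitzWith 1 S' := by
      refine AddMonoidHomClass.antilipschitz_of_bound S' fun x => ?_
      rw [NNReal.coe_one, one_mul]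
      exact hnorm _ (hG x.2)
    exact hanti.isClosed_range S'.uniformContinuous
  have htop : LinearMap.range S'.toLinearMap = ⊤ := by
    have hclR : IsClosed ((LinearMap.range S'.toLinearMap : Submodule ℂ H) : Set H) := by
      rw [LinearMap.coe_range]
      exact hcl
    rw [← hclR.submodule_topologicalClosure_eq, Submodule.topologicalClosure_eq_top_iff,
      Submodule.eq_bot_iff]
    intro u hu
    refine hrange u fun x hx => ?_
    rw [Submodule.mem_orthogonal'] at hu
    exact hu _ ⟨⟨x, T.graph.le_topologicalClosure hx⟩, rfl⟩
  -- A surjective restriction of an injective map is the whole map: the closure of `T` plus `i` is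
  -- already onto and the generator plus `i` is injective, so the generator has no further elements.
  obtain ⟨x, hx⟩ : ∃ x, S' x = S (f, g) := by
    have : S (f, g) ∈ LinearMap.range S'.toLinearMap := htop ▸ Submodule.mem_top
    exact this
  have hz : (f, g) - (x : H × H) ∈ generatorGraph V := sub_mem h (hG x.2)
  have h1 := hnorm _ hz
  rw [← hSa, map_sub, ← hx] at h1
  have h2 : (f, g) - (x : H × H) = 0 := by
    rw [← norm_le_zero_iff]
    refine h1.trans (le_of_eq ?_)
    simp [hS']
  rw [sub_eq_zero.1 h2]
  exact x.2

end UnitaryGroup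

/-! ### A total invariant set in the domain of the closure determines the generator. -/

section UnitaryGroup

variable {H : Type*} [NormedAddCommGroup H] [InnerProductSpace ℂ H]

/-- If the generator of a unitary group extends `T`, and the domain of the closure of `T` contains
a total set which is invariant under the group, then the closure of `T` generates the group. -/
theorem isUnitaryGroup_closure_of_core [CompleteSpace H] {T : H →ₗ.[ℂ] H}
    {V : ℝ → (H ≃ₗᵢ[ℂ] H)} (h0 : ∀ f, V 0 f = f) (hadd : ∀ s t f, V (s + t) f = V s (V t f))
    (hcont : ∀ f, Continuous fun t => V t f) (hT : T.graph ≤ generatorGraph V) (D : Set H)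
    (hinv : ∀ f ∈ D, ∀ t, V t f ∈ D) (hD : ∀ f ∈ D, ∃ g, (f, g) ∈ T.graph.topologicalClosure)
    (htot : ∀ u : H, (∀ f ∈ D, inner ℂ u f = 0) → u = 0) :
    T.IsClosable ∧ IsUnitaryGroup T.closure V := by
  refine isUnitaryGroup_closure h0 hadd hcont hT fun u hu => htot u fun f hf => ?_
  have hu' : ∀ x ∈ T.graph.topologicalClosure, inner ℂ u (x.2 + Complex.I • x.1) = 0 := by
    intro x hx
    have hcl : IsClosed {x : H × H | inner ℂ u (x.2 + Complex.I • x.1) = 0} :=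
      isClosed_eq (by fun_prop) continuous_const
    exact closure_minimal (s := (T.graph : Set (H × H))) (fun y hy => hu y hy) hcl hx
  have hG : T.graph.topologicalClosure ≤ generatorGraph V :=
    Submodule.topologicalClosure_minimal _ hT (isClosed_generatorGraph h0 hadd)
  -- If `u` is orthogonal to the range of the closure plus `i`, then `h(τ) = ⟨u, V τ f⟩` satisfies
  -- `h' = -h`, because the orbit stays in `D`. The bounded function `h` must then vanish, as `e^τ
  -- h(τ)` is constant and tends to zero at `-∞`.
  have hd : ∀ τ : ℝ, HasDerivAt (fun τ => inner ℂ u (V τ f)) (-inner ℂ u (V τ f)) τ := by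
    intro τ
    obtain ⟨g, hg⟩ := hD _ (hinv f hf τ)
    have h1 := hu' _ hg
    rw [inner_add_right, inner_smul_right] at h1
    have h2 : HasDerivAt (fun t => V t (V τ f)) (-Complex.I • g) (τ - τ) := by
      rw [sub_self]
      exact hG hg
    have h3 := HasDerivAt.inner ℂ (hasDerivAt_const τ u) (h2.comp_sub_const τ τ)
    simp only [← hadd, sub_add_cancel, inner_zero_left, add_zero, inner_smul_right] at h3
    refine h3.congr_deriv ?_
    linear_combination -Complex.I * h1 + inner ℂ u (V τ f) * Complex.I_mul_I
  have hd2 : ∀ τ : ℝ, HasDerivAt (fun τ : ℝ => Complex.exp τ * inner ℂ u (V τ f)) 0 τ := by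
    intro τ
    have h1 : HasDerivAt (fun τ : ℝ => Complex.exp τ) (Complex.exp τ) τ :=
      (Complex.hasDerivAt_exp τ).comp_ofReal
    refine (h1.mul (hd τ)).congr_deriv ?_
    ring
  have hc : ∀ τ : ℝ, ‖(inner ℂ u f : ℂ)‖ ≤ Real.exp τ * (‖u‖ * ‖f‖) := by
    intro τ
    have h := is_const_of_deriv_eq_zero (fun s => (hd2 s).differentiableAt)
      (fun s => (hd2 s).deriv) 0 τ
    simp only [Complex.ofReal_zero, Complex.exp_zero, one_mul, h0] at h
    rw [h, norm_mul, Complex.norm_exp_ofReal]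
    refine mul_le_mul_of_nonneg_left ?_ (Real.exp_pos _).le
    simpa using norm_inner_le_norm (𝕜 := ℂ) u (V τ f)
  have hlim := (Real.tendsto_exp_atBot.mul_const (‖u‖ * ‖f‖))
  rw [zero_mul] at hlim
  have := ge_of_tendsto' hlim hc
  exact norm_le_zero_iff.1 this

end UnitaryGroup

/-! ### Quadratic remainder estimates. -/

theorem hasDerivAt_zero_of_norm_le_sq {E : Type*} [NormedAddCommGroup E] [NormedSpace ℝ E]
    {F : ℝ → E} {g : E} (C : ℝ) (h : ∀ t, ‖F t - F 0 - t • g‖ ≤ C * t ^ 2) :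
    HasDerivAt F g 0 := by
  rw [hasDerivAt_iff_isLittleO]
  simp only [sub_zero]
  refine Asymptotics.IsBigO.trans_isLittleO (g := fun t : ℝ => t ^ 2) ?_ ?_
  · refine Asymptotics.IsBigO.of_bound C (Eventually.of_forall fun t => ?_)
    simpa using h t
  · exact Asymptotics.isLittleO_pow_id one_lt_two

/-- Taylor's formula serves for `|y| ≤ 1`; for `|y| > 1` the trivial bound `2 + |y|` is at most `3
y²`, whence the constant. -/
theorem norm_exp_neg_mul_I_sub_le (y : ℝ) :
    ‖Complex.exp (-(Complex.I * y)) - 1 + Complex.I * y‖ ≤ 3 * y ^ 2 := by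
  have hn : ‖-(Complex.I * (y : ℂ))‖ = |y| := by simp
  rcases le_or_gt |y| 1 with h | h
  · have := Complex.norm_exp_sub_one_sub_id_le (x := -(Complex.I * y)) (by rwa [hn])
    rw [hn, sq_abs, sub_neg_eq_add] at this
    nlinarith [sq_nonneg y]
  · have h1 : ‖Complex.exp (-(Complex.I * y))‖ = 1 := by simp [Complex.norm_exp]
    have h2 := norm_add_le (Complex.exp (-(Complex.I * y)) - 1) (Complex.I * y)
    have h3 := norm_sub_le (Complex.exp (-(Complex.I * y))) 1
    have h4 : ‖Complex.I * (y : ℂ)‖ = |y| := by simp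
    rw [h1, norm_one] at h3
    rw [← sq_abs]
    nlinarith

/-! ### Multiplication by `e^{-itx}` -/

theorem memLp_exp_mul (t : ℝ) (F : Lp ℂ 2 halfLine) :
    MemLp (fun x : ℝ => Complex.exp (-(Complex.I * (t * x : ℝ))) * F x) 2 halfLine := by
  refine (Lp.memLp F).of_le ?_ (Eventually.of_forall fun x => ?_)
  · exact (by fun_prop : Measurable fun x : ℝ => Complex.exp (-(Complex.I * (t * x : ℝ)))
      ).aestronglyMeasurable.mul (Lp.aestronglyMeasurable F)
  · simp [Complex.norm_exp]

/-- Multiplication by `e^{-itx}` in `L²(ℝ₊)`. -/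
def mulExp (t : ℝ) : Lp ℂ 2 halfLine →ₗᵢ[ℂ] Lp ℂ 2 halfLine where
  toFun F := (memLp_exp_mul t F).toLp _
  map_add' F G := by
    ext1
    filter_upwards [(memLp_exp_mul t (F + G)).coeFn_toLp, (memLp_exp_mul t F).coeFn_toLp,
      (memLp_exp_mul t G).coeFn_toLp, Lp.coeFn_add F G,
      Lp.coeFn_add ((memLp_exp_mul t F).toLp _) ((memLp_exp_mul t G).toLp _)]
      with x h1 h2 h3 h4 h5
    rw [h1, h5, Pi.add_apply, h2, h3, h4, Pi.add_apply, mul_add]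
  map_smul' c F := by
    ext1
    filter_upwards [(memLp_exp_mul t (c • F)).coeFn_toLp, (memLp_exp_mul t F).coeFn_toLp,
      Lp.coeFn_smul c F, Lp.coeFn_smul c ((memLp_exp_mul t F).toLp _)] with x h1 h2 h3 h4
    rw [h1, RingHom.id_apply, h4, Pi.smul_apply, h2, h3, Pi.smul_apply, smul_eq_mul, smul_eq_mul,
      mul_left_comm]
  norm_map' F := by
    refine le_antisymm ?_ ?_
    · refine Lp.norm_le_norm_of_ae_le ?_
      filter_upwards [(memLp_exp_mul t F).coeFn_toLp] with x h1
      simp only [LinearMap.coe_mk, AddHom.coe_mk]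
      rw [h1]
      simp [Complex.norm_exp]
    · refine Lp.norm_le_norm_of_ae_le ?_
      filter_upwards [(memLp_exp_mul t F).coeFn_toLp] with x h1
      simp only [LinearMap.coe_mk, AddHom.coe_mk]
      rw [h1]
      simp [Complex.norm_exp]

theorem coeFn_mulExp (t : ℝ) (F : Lp ℂ 2 halfLine) :
    mulExp t F =ᵐ[halfLine] fun x => Complex.exp (-(Complex.I * (t * x : ℝ))) * F x :=
  (memLp_exp_mul t F).coeFn_toLp

theorem mulExp_zero (F : Lp ℂ 2 halfLine) : mulExp 0 F = F := by
  ext1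
  filter_upwards [coeFn_mulExp 0 F] with x h
  simp [h]

theorem mulExp_add (s t : ℝ) (F : Lp ℂ 2 halfLine) :
    mulExp (s + t) F = mulExp s (mulExp t F) := by
  ext1
  filter_upwards [coeFn_mulExp (s + t) F, coeFn_mulExp t F, coeFn_mulExp s (mulExp t F)]
    with x h1 h2 h3
  rw [h1, h3, h2, ← mul_assoc, ← Complex.exp_add]
  congr 2
  push_cast
  ring

theorem mulExp_coherentVec {p : ℝ} (hp : -1 < p) {s s' : ℂ} (hs : 1 / 2 < s.re)
    (hs' : 1 / 2 < s'.re) (t : ℝ) (h : s' = s + Complex.I * t) :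
    mulExp t (coherentVec p hp hs) = coherentVec p hp hs' := by
  ext1
  filter_upwards [coeFn_mulExp t (coherentVec p hp hs), coeFn_coherentVec hp hs,
    coeFn_coherentVec hp hs'] with x h1 h2 h3
  rw [h1, h2, h3, coherentFun, coherentFun, mul_left_comm, ← Complex.exp_add, h]
  congr 2
  push_cast
  ring

/-! ### The Laguerre group -/

/-- The vectors with this property form a closed subspace. It contains the coherent states with real
parameter, which multiplication by `e^{-itx}` turns into coherent states again, and these are total.
-/
theorem mulExp_Phi_mem_range (p : ℝ) (hp : -1 < p) (t : ℝ) (f : SeqSpace) :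
    mulExp t (Phi p hp f) ∈ (Phi p hp).range := by
  set K : Submodule ℂ SeqSpace :=
    ((Phi p hp).range).comap ((mulExp t).comp (Phi p hp)).toLinearMap with hK
  have hKm : ∀ f, f ∈ K ↔ mulExp t (Phi p hp f) ∈ (Phi p hp).range := fun f => Iff.rfl
  have hcl : IsClosed (K : Set SeqSpace) := by
    have h1 : IsClosed (Set.range (Phi p hp)) :=
      (Phi p hp).isometry.isClosedEmbedding.isClosed_range
    exact h1.preimage ((mulExp t).comp (Phi p hp)).continuous
  have htop : K = ⊤ := by
    rw [← hcl.submodule_topologicalClosure_eq, Submodule.topologicalClosure_eq_top_iff,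
      Submodule.eq_bot_iff]
    intro u hu
    rw [Submodule.mem_orthogonal'] at hu
    refine eq_zero_of_inner_coherentState hp u fun s hs => hu _ ?_
    have hs' : 1 / 2 < ((s : ℂ) + Complex.I * t).re := by simpa using hs
    rw [hKm, Phi_coherentState, mulExp_coherentVec hp hs hs' t rfl, ← Phi_coherentState]
    exact ⟨_, rfl⟩
  exact (hKm f).1 (htop ▸ Submodule.mem_top)

/-- The operator `Φ_p⁻¹ e^{-itx} Φ_p`. -/
def laguerreMap (p : ℝ) (hp : -1 < p) (t : ℝ) : SeqSpace →ₗ[ℂ] SeqSpace :=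
  (Phi p hp).equivRange.symm.toLinearEquiv.toLinearMap ∘ₗ
    ((mulExp t).comp (Phi p hp)).toLinearMap.codRestrict (Phi p hp).range
      (mulExp_Phi_mem_range p hp t)

theorem Phi_laguerreMap (p : ℝ) (hp : -1 < p) (t : ℝ) (f : SeqSpace) :
    Phi p hp (laguerreMap p hp t f) = mulExp t (Phi p hp f) := by
  have h := (Phi p hp).equivRange.apply_symm_apply
    ⟨mulExp t (Phi p hp f), mulExp_Phi_mem_range p hp t f⟩
  exact congrArg Subtype.val h

theorem laguerreMap_add (p : ℝ) (hp : -1 < p) (s t : ℝ) (f : SeqSpace) :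
    laguerreMap p hp (s + t) f = laguerreMap p hp s (laguerreMap p hp t f) :=
  (Phi p hp).injective (by simp only [Phi_laguerreMap, mulExp_add])

theorem laguerreMap_zero (p : ℝ) (hp : -1 < p) (f : SeqSpace) : laguerreMap p hp 0 f = f :=
  (Phi p hp).injective (by simp only [Phi_laguerreMap, mulExp_zero])

/-- The unitary group `Φ_p⁻¹ e^{-itx} Φ_p`. -/
def laguerreGroup (p : ℝ) (hp : -1 < p) (t : ℝ) : SeqSpace ≃ₗᵢ[ℂ] SeqSpace where
  toLinearEquiv := LinearEquiv.ofLinearMap (laguerreMap p hp t) (laguerreMap p hp (-t))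
    (LinearMap.ext fun f => by simp [← laguerreMap_add, laguerreMap_zero])
    (LinearMap.ext fun f => by simp [← laguerreMap_add, laguerreMap_zero])
  norm_map' f := by
    change ‖laguerreMap p hp t f‖ = ‖f‖
    rw [← (Phi p hp).norm_map, Phi_laguerreMap, (mulExp t).norm_map, (Phi p hp).norm_map]

theorem Phi_laguerreGroup (p : ℝ) (hp : -1 < p) (t : ℝ) (f : SeqSpace) :
    Phi p hp (laguerreGroup p hp t f) = mulExp t (Phi p hp f) := Phi_laguerreMap p hp t f

theorem laguerreGroup_zero (p : ℝ) (hp : -1 < p) (f : SeqSpace) : laguerreGroup p hp 0 f = f :=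
  laguerreMap_zero p hp f

theorem laguerreGroup_add (p : ℝ) (hp : -1 < p) (s t : ℝ) (f : SeqSpace) :
    laguerreGroup p hp (s + t) f = laguerreGroup p hp s (laguerreGroup p hp t f) :=
  laguerreMap_add p hp s t f

theorem laguerreGroup_coherentState {p : ℝ} (hp : -1 < p) {s s' : ℂ} (hs : 1 / 2 < s.re)
    (hs' : 1 / 2 < s'.re) (t : ℝ) (h : s' = s + Complex.I * t) :
    laguerreGroup p hp t (coherentState p hp hs) = coherentState p hp hs' :=
  (Phi p hp).injective (by
    rw [Phi_laguerreGroup, Phi_coherentState, Phi_coherentState, mulExp_coherentVec hp hs hs' t h])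

/-! ### The columns of the Jacobi matrix -/

/-- The standard basis of `ℓ²(ℤ₊)`. -/
def basisVec (n : ℕ) : SeqSpace := lp.single 2 n (1 : ℂ)

theorem basisVec_apply (n m : ℕ) : basisVec n m = if m = n then 1 else 0 := by
  rw [basisVec, lp.single_apply, Pi.single_apply]

theorem basisVec_mem (n : ℕ) : basisVec n ∈ finiteVectors := by
  refine (Set.finite_singleton n).subset fun m hm => ?_
  by_contra h
  exact hm (by rw [basisVec_apply]; exact if_neg h)

theorem Phi_basisVec (p : ℝ) (hp : -1 < p) (n : ℕ) :
    Phi p hp (basisVec n) = laguerreVec p hp n := by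
  rw [Phi, basisVec, OrthogonalFamily.linearIsometry_apply_single]
  simp

/-- The `n`-th column of the Jacobi matrix of the Laguerre operator. -/
def jacobiCol (p : ℝ) : ℕ → SeqSpace
  | 0 => (diag p 0 : ℂ) • basisVec 0 + (offDiag p 0 : ℂ) • basisVec 1
  | n + 1 => (offDiag p n : ℂ) • basisVec n + (diag p (n + 1) : ℂ) • basisVec (n + 1)
      + (offDiag p (n + 1) : ℂ) • basisVec (n + 2)

theorem basisVec_jacobiCol_mem_graph (p : ℝ) (n : ℕ) :
    (basisVec n, jacobiCol p n) ∈ (minimalJacobi (offDiag p) (diag p)).graph := by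
  rw [LinearPMap.mem_graph_iff]
  refine ⟨⟨basisVec n, basisVec_mem n⟩, rfl, ?_⟩
  ext m
  change jacobiMatrix (offDiag p) (diag p) (basisVec n) m = jacobiCol p n m
  rcases n with _ | n <;> rcases m with _ | m <;>
    simp only [jacobiMatrix, jacobiCol, lp.coeFn_add, lp.coeFn_smul, Pi.add_apply, Pi.smul_apply,
      smul_eq_mul, basisVec_apply]
  · simp
  · rcases m with _ | m <;> simp
  · rcases n with _ | n <;> simp
  · rcases lt_trichotomy m n with h | h | h
    · rcases Nat.lt_or_ge (m + 1) n with h' | h'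
      · simp [h.ne, h'.ne, show m + 2 ≠ n + 1 by omega, show m ≠ n + 1 by omega]
      · obtain rfl : n = m + 1 := by omega
        simp [show m ≠ m + 1 + 1 by omega]
    · subst h
      simp
    · rcases Nat.lt_or_ge (n + 1) m with h' | h'
      · simp [h.ne', h'.ne', show m + 1 ≠ n by omega, show m + 2 ≠ n + 1 by omega]
      · obtain rfl : m = n + 1 := by omega
        simp [show n + 1 + 1 ≠ n by omega]

theorem coeFn_Phi_jacobiCol {p : ℝ} (hp : -1 < p) (n : ℕ) :
    Phi p hp (jacobiCol p n) =ᵐ[halfLine] fun x => ((x * laguerreFun p n x : ℝ) : ℂ) := by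
  rcases n with _ | n
  · simp only [jacobiCol, map_add, map_smul, Phi_basisVec]
    filter_upwards [Lp.coeFn_add ((diag p 0 : ℂ) • laguerreVec p hp 0)
        ((offDiag p 0 : ℂ) • laguerreVec p hp 1),
      Lp.coeFn_smul (diag p 0 : ℂ) (laguerreVec p hp 0),
      Lp.coeFn_smul (offDiag p 0 : ℂ) (laguerreVec p hp 1),
      coeFn_laguerreVec hp 0, coeFn_laguerreVec hp 1] with x h1 h2 h3 h4 h5
    rw [h1, Pi.add_apply, h2, h3, Pi.smul_apply, Pi.smul_apply, h4, h5, smul_eq_mul, smul_eq_mul]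
    norm_cast
    rw [laguerreFun, laguerreFun]
    linear_combination -√(weight p x) * rec_zero hp x
  · simp only [jacobiCol, map_add, map_smul, Phi_basisVec]
    filter_upwards [Lp.coeFn_add ((offDiag p n : ℂ) • laguerreVec p hp n
        + (diag p (n + 1) : ℂ) • laguerreVec p hp (n + 1))
        ((offDiag p (n + 1) : ℂ) • laguerreVec p hp (n + 2)),
      Lp.coeFn_add ((offDiag p n : ℂ) • laguerreVec p hp n)
        ((diag p (n + 1) : ℂ) • laguerreVec p hp (n + 1)),
      Lp.coeFn_smul (offDiag p n : ℂ) (laguerreVec p hp n),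
      Lp.coeFn_smul (diag p (n + 1) : ℂ) (laguerreVec p hp (n + 1)),
      Lp.coeFn_smul (offDiag p (n + 1) : ℂ) (laguerreVec p hp (n + 2)),
      coeFn_laguerreVec hp n, coeFn_laguerreVec hp (n + 1), coeFn_laguerreVec hp (n + 2)]
      with x h1 h2 h3 h4 h5 h6 h7 h8
    rw [h1, Pi.add_apply, h2, Pi.add_apply, h3, h4, h5, Pi.smul_apply, Pi.smul_apply,
      Pi.smul_apply, h6, h7, h8, smul_eq_mul, smul_eq_mul, smul_eq_mul]
    norm_cast
    rw [laguerreFun, laguerreFun, laguerreFun]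
    linear_combination -√(weight p x) * rec_succ hp n x

theorem memLp_sq_mul_laguerreFun {p : ℝ} (hp : -1 < p) (n : ℕ) :
    MemLp (fun x => ((x ^ 2 * laguerreFun p n x : ℝ) : ℂ)) 2 halfLine := by
  have hm : Measurable fun x => x ^ 2 * laguerreFun p n x :=
    (by fun_prop : Measurable fun x : ℝ => x ^ 2).mul (measurable_laguerreFun p n)
  refine MemLp.ofReal ((memLp_two_iff_integrable_sq hm.aestronglyMeasurable).2 ?_)
  refine IntegrableOn.congr_fun
    (integrable_poly hp (Polynomial.X ^ 4 * (laguerrePoly p n * laguerrePoly p n)))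
    (fun x hx => ?_) measurableSet_Ioi
  rw [Polynomial.eval_mul, mul_assoc, ← laguerreFun_mul hp n n hx]
  simp
  ring

/-- Under `Φ_p` the Jacobi column becomes `x φₙ`, so the remainder is `(e^{-itx} - 1 + itx) φₙ`,
bounded pointwise by `3 t² x² |φₙ|` with `x² φₙ` in `L²`. -/
theorem hasDerivAt_laguerreGroup_basisVec {p : ℝ} (hp : -1 < p) (n : ℕ) :
    HasDerivAt (fun t => laguerreGroup p hp t (basisVec n)) (-Complex.I • jacobiCol p n) 0 := by
  set G := (memLp_sq_mul_laguerreFun hp n).toLp _ with hG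
  refine hasDerivAt_zero_of_norm_le_sq (3 * ‖G‖) fun t => ?_
  rw [laguerreGroup_zero, ← (Phi p hp).norm_map, mul_right_comm]
  have hts : t • (-Complex.I • jacobiCol p n) = (-(Complex.I * t)) • jacobiCol p n := by
    refine (Complex.coe_smul t (-Complex.I • jacobiCol p n)).symm.trans ?_
    rw [smul_smul]
    congr 1
    ring
  rw [hts, map_sub, map_sub, map_smul, Phi_laguerreGroup, Phi_basisVec]
  refine Lp.norm_le_mul_norm_of_ae_le_mul ?_
  filter_upwards [Lp.coeFn_sub (mulExp t (laguerreVec p hp n) - laguerreVec p hp n)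
      ((-(Complex.I * t)) • Phi p hp (jacobiCol p n)),
    Lp.coeFn_sub (mulExp t (laguerreVec p hp n)) (laguerreVec p hp n),
    Lp.coeFn_smul (-(Complex.I * t)) (Phi p hp (jacobiCol p n)),
    coeFn_mulExp t (laguerreVec p hp n), coeFn_Phi_jacobiCol hp n, coeFn_laguerreVec hp n,
    (memLp_sq_mul_laguerreFun hp n).coeFn_toLp] with x h1 h2 h3 h4 h5 h6 h7
  rw [h1, Pi.sub_apply, h2, Pi.sub_apply, h3, Pi.smul_apply, h4, h5, h6, hG, h7]
  have e : Complex.exp (-(Complex.I * (t * x : ℝ))) * (laguerreFun p n x : ℂ) - laguerreFun p n x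
      - (-(Complex.I * t)) • ((x * laguerreFun p n x : ℝ) : ℂ)
      = (Complex.exp (-(Complex.I * (t * x : ℝ))) - 1 + Complex.I * (t * x : ℝ))
        * (laguerreFun p n x : ℂ) := by
    rw [smul_eq_mul]
    push_cast
    ring
  rw [e, norm_mul, Complex.ofReal_mul (x ^ 2), norm_mul ((x ^ 2 : ℝ) : ℂ)]
  refine (mul_le_mul_of_nonneg_right (norm_exp_neg_mul_I_sub_le (t * x)) (norm_nonneg _)).trans
    (le_of_eq ?_)
  rw [Complex.norm_real (x ^ 2), Real.norm_of_nonneg (sq_nonneg x)]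
  ring

theorem hasSum_basisVec (f : SeqSpace) : HasSum (fun n => f n • basisVec n) f := by
  have h := lp.hasSum_single (E := fun _ : ℕ => ℂ) (p := 2) (by simp) f
  refine h.congr_fun fun n => ?_
  rw [basisVec, ← lp.single_smul, smul_eq_mul, mul_one]

theorem dense_finiteVectors : Dense (finiteVectors : Set SeqSpace) := fun f =>
  mem_closure_of_tendsto (hasSum_basisVec f) (Eventually.of_forall fun _ =>
    sum_mem fun n _ => finiteVectors.smul_mem _ (basisVec_mem n))

theorem minimalJacobi_graph_le {p : ℝ} (hp : -1 < p) :
    (minimalJacobi (offDiag p) (diag p)).graph ≤ generatorGraph (laguerreGroup p hp) := by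
  rintro ⟨f, g⟩ h
  have hf : f ∈ finiteVectors := LinearPMap.mem_domain_of_mem_graph h
  have hfin : {n | f n ≠ 0}.Finite := hf
  set x : SeqSpace × SeqSpace := ∑ n ∈ hfin.toFinset, f n • (basisVec n, jacobiCol p n) with hx
  have h1 : x ∈ (minimalJacobi (offDiag p) (diag p)).graph :=
    sum_mem fun n _ => Submodule.smul_mem _ _ (basisVec_jacobiCol_mem_graph p n)
  have h2 : x ∈ generatorGraph (laguerreGroup p hp) :=
    sum_mem fun n _ => Submodule.smul_mem _ _ (hasDerivAt_laguerreGroup_basisVec hp n)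
  have h3 : x.1 = f := by
    rw [hx, Prod.fst_sum]
    refine HasSum.unique (hasSum_sum_of_ne_finset_zero fun n hn => ?_) (hasSum_basisVec f)
    have : f n = 0 := by simpa using hn
    simp [this]
  have h4 : (f, g) = x :=
    Prod.ext h3.symm (LinearPMap.mem_graph_snd_inj' _ h h1 h3.symm)
  rw [h4]
  exact h2

/-- Orbits of finite vectors are differentiable at zero; isometry and density extend continuity at
zero to every vector, and the group law moves it to every `t`. -/
theorem continuous_laguerreGroup {p : ℝ} (hp : -1 < p) (f : SeqSpace) :
    Continuous fun t => laguerreGroup p hp t f := by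
  have h0 : ∀ f : SeqSpace, Tendsto (fun t => laguerreGroup p hp t f) (𝓝 0) (𝓝 f) := by
    intro f
    rw [Metric.tendsto_nhds]
    intro ε hε
    obtain ⟨g, hg, hfg⟩ := Metric.dense_iff.1 dense_finiteVectors f (ε / 3) (by positivity)
    have hg' : dist f g < ε / 3 := by rw [dist_comm]; exact hg
    obtain ⟨g', hgg⟩ : ∃ g', (g, g') ∈ (minimalJacobi (offDiag p) (diag p)).graph :=
      ⟨_, LinearPMap.mem_graph _ ⟨g, hfg⟩⟩
    have hc := (mem_generatorGraph.1 (minimalJacobi_graph_le hp hgg)).continuousAt.tendsto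
    simp only [laguerreGroup_zero] at hc
    filter_upwards [Metric.tendsto_nhds.1 hc (ε / 3) (by positivity)] with t ht
    have h1 : dist (laguerreGroup p hp t f) (laguerreGroup p hp t g) < ε / 3 := by
      rwa [(laguerreGroup p hp t).dist_map]
    have := dist_triangle4 (laguerreGroup p hp t f) (laguerreGroup p hp t g) g f
    rw [dist_comm g f] at this
    linarith
  rw [continuous_iff_continuousAt]
  intro t
  have h1 : Tendsto (fun s : ℝ => s - t) (𝓝 t) (𝓝 0) := by
    simpa using (continuous_sub_right t).tendsto t
  have h2 := ((laguerreGroup p hp t).continuous.tendsto f).comp ((h0 f).comp h1)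
  refine h2.congr fun s => ?_
  simp only [Function.comp_apply]
  rw [← laguerreGroup_add, add_sub_cancel]

/-! ### Coherent states in the domain of the closure, and identification of the group. -/

theorem offDiag_le {p : ℝ} (hp : -1 < p) (n : ℕ) : offDiag p n ≤ n + 1 + |p| := by
  have h := offDiag_sq hp n
  have hn : (0 : ℝ) ≤ n := n.cast_nonneg
  have h1 := le_abs_self p
  have h2 := abs_nonneg p
  refine (sq_le_sq₀ (offDiag_pos hp n).le (by positivity)).1 ?_
  nlinarith

theorem norm_basisVec (n : ℕ) : ‖basisVec n‖ = 1 := by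
  rw [basisVec, lp.norm_single (by simp), norm_one]

theorem norm_jacobiCol_le {p : ℝ} (hp : -1 < p) (n : ℕ) :
    ‖jacobiCol p n‖ ≤ (6 + 3 * |p|) * (n + 1) := by
  have h2 := abs_nonneg p
  have hsm : ∀ (c : ℝ) (m : ℕ), ‖(c : ℂ) • basisVec m‖ = |c| := fun c m => by
    rw [norm_smul, norm_basisVec, mul_one, Complex.norm_real, Real.norm_eq_abs]
  have hd : ∀ m : ℕ, |diag p m| ≤ 2 * m + |p| + 1 := fun m => by
    have hm : (0 : ℝ) ≤ m := m.cast_nonneg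
    rw [diag]
    refine (abs_add_le _ _).trans ?_
    have := abs_add_le (2 * (m : ℝ)) p
    rw [abs_of_nonneg (by positivity : (0 : ℝ) ≤ 2 * m)] at this
    rw [abs_one]
    linarith
  have ho : ∀ m : ℕ, |offDiag p m| ≤ m + 1 + |p| := fun m => by
    rw [abs_of_pos (offDiag_pos hp m)]
    exact offDiag_le hp m
  rcases n with _ | n
  · refine (norm_add_le _ _).trans ?_
    rw [hsm, hsm]
    have h3 := hd 0
    have h4 := ho 0
    push_cast at h3 h4 ⊢
    linarith
  · refine (norm_add_le _ _).trans ((add_le_add_left (norm_add_le _ _) _).trans ?_)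
    rw [hsm, hsm, hsm]
    have hn : (0 : ℝ) ≤ n := n.cast_nonneg
    have h3 := hd (n + 1)
    have h4 := ho n
    have h5 := ho (n + 1)
    push_cast at h3 h4 h5 ⊢
    nlinarith

/-- Split `qⁿ = rⁿ (q/r)ⁿ` with `q < r < 1` and bound the product by a sum of squares: one square is
a term of the binomial series, the other a polynomial times a geometric term. -/
theorem summable_normCoeff_mul {p : ℝ} (hp : -1 < p) {q : ℝ} (hq0 : 0 ≤ q) (hq : q < 1) :
    Summable fun n : ℕ => normCoeff p n * q ^ n * (n + 1) := by
  set r := (1 + q) / 2 with hr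
  have hr0 : 0 < r := by positivity
  have hr1 : r < 1 := by linarith
  have hqr : q / r < 1 := by rw [div_lt_one hr0]; linarith
  have hqr0 : 0 ≤ q / r := by positivity
  have h1 := (hasSum_normCoeff_sq hp (x := r ^ 2) (by rw [abs_of_pos (by positivity)]; nlinarith)
    ).summable
  have hx : |(q / r) ^ 2| < 1 := by
    rw [abs_of_nonneg (by positivity)]
    nlinarith
  have h2 : Summable fun n : ℕ => ((n : ℝ) + 1) ^ 2 * ((q / r) ^ 2) ^ n := by
    have a0 := summable_pow_mul_geometric_of_norm_lt_one 0 (r := (q / r) ^ 2) hx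
    have a1 := summable_pow_mul_geometric_of_norm_lt_one 1 (r := (q / r) ^ 2) hx
    have a2 := summable_pow_mul_geometric_of_norm_lt_one 2 (r := (q / r) ^ 2) hx
    refine ((a0.add (a1.mul_left 2)).add a2).congr fun n => ?_
    ring
  refine Summable.of_nonneg_of_le (fun n => ?_) (fun n => ?_) (h1.add h2)
  · have := (normCoeff_pos hp n).le
    positivity
  · have e : normCoeff p n * q ^ n * (n + 1)
        = (normCoeff p n * r ^ n) * ((n + 1) * (q / r) ^ n) := by
      have h3 : r ^ n * (q / r) ^ n = q ^ n := by rw [← mul_pow, mul_div_cancel₀ _ hr0.ne']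
      generalize q / r = y at h3 ⊢
      linear_combination -(normCoeff p n * (n + 1)) * h3
    rw [e]
    have h3 := two_mul_le_add_sq (normCoeff p n * r ^ n) ((n + 1) * (q / r) ^ n)
    have h4 : 0 ≤ (normCoeff p n * r ^ n) * ((n + 1) * (q / r) ^ n) := by
      have := (normCoeff_pos hp n).le
      positivity
    calc _ ≤ (normCoeff p n * r ^ n) ^ 2 + ((n + 1) * (q / r) ^ n) ^ 2 := by linarith
      _ = _ := by
        rw [mul_pow, mul_pow, pow_right_comm r, pow_right_comm (q / r)]

/-- The columns of the matrix grow at most linearly, so the series of columns weighted by the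
coherent coefficients converges absolutely; its partial sums are the images of the truncations of
the state. -/
theorem exists_coherentState_mem_closure {p : ℝ} (hp : -1 < p) {s : ℂ} (hs : 1 / 2 < s.re) :
    ∃ g, (coherentState p hp hs, g)
      ∈ (minimalJacobi (offDiag p) (diag p)).graph.topologicalClosure := by
  have hsum : Summable fun n => coherentSeq p s n • jacobiCol p n := by
    have h := (summable_normCoeff_mul hp (norm_nonneg (1 / s - 1)) (norm_one_div_sub_one_lt hs)
      ).mul_left (‖(1 / s) ^ ((p + 1 : ℝ) : ℂ)‖ * (6 + 3 * |p|))
    refine Summable.of_norm_bounded h fun n => ?_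
    rw [norm_smul, coherentSeq, norm_mul, norm_mul, norm_pow, Complex.norm_real,
      Real.norm_of_nonneg (normCoeff_pos hp n).le]
    refine (mul_le_mul_of_nonneg_left (norm_jacobiCol_le hp n) ?_).trans (le_of_eq (by ring))
    have := (normCoeff_pos hp n).le
    positivity
  obtain ⟨g, hg⟩ := hsum
  refine ⟨g, ?_⟩
  have h := (hasSum_basisVec (coherentState p hp hs)).prodMk hg
  refine mem_closure_of_tendsto h (Eventually.of_forall fun S => ?_)
  exact sum_mem fun n _ => Submodule.smul_mem _ _ (basisVec_jacobiCol_mem_graph p n)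

theorem isUnitaryGroup_laguerreGroup (p : ℝ) (hp : -1 < p) :
    IsUnitaryGroup (laguerreOperator p) (laguerreGroup p hp) := by
  refine (isUnitaryGroup_closure_of_core (laguerreGroup_zero p hp) (laguerreGroup_add p hp)
    (continuous_laguerreGroup hp) (minimalJacobi_graph_le hp)
    {f | ∃ (s : ℂ) (hs : 1 / 2 < s.re), f = coherentState p hp hs} ?_ ?_ ?_).2
  · rintro _ ⟨s, hs, rfl⟩ t
    have hs' : 1 / 2 < (s + Complex.I * t).re := by simpa using hs
    exact ⟨_, hs', laguerreGroup_coherentState hp hs hs' t rfl⟩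
  · rintro _ ⟨s, hs, rfl⟩
    exact exists_coherentState_mem_closure hp hs
  · intro u hu
    exact eq_zero_of_inner_coherentState hp u fun s hs => hu _ ⟨s, hs, rfl⟩

theorem dense_domain_laguerreOperator (p : ℝ) :
    Dense ((laguerreOperator p).domain : Set SeqSpace) :=
  dense_finiteVectors.mono (minimalJacobi (offDiag p) (diag p)).le_closure.1

theorem unitaryGroup_laguerreOperator (p : ℝ) (hp : -1 < p) :
    unitaryGroup (laguerreOperator p) = laguerreGroup p hp := by
  have h : ∃ V, IsUnitaryGroup (laguerreOperator p) V := ⟨_, isUnitaryGroup_laguerreGroup p hp⟩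
  rw [unitaryGroup, dif_pos h]
  exact h.choose_spec.unique (dense_domain_laguerreOperator p) (isUnitaryGroup_laguerreGroup p hp)

/-! ### Riemann sums -/

theorem integral_comp_floor (K : ℕ → ℂ) (N : ℕ) (hK : ∀ n, N ≤ n → K n = 0) :
    ∫ y in Set.Ioi (0 : ℝ), K ⌊y⌋₊ = ∑' n, K n := by
  have hs : ∀ y ∈ Set.Ici (0 : ℝ), K ⌊y⌋₊
      = ∑ n ∈ Finset.range N, (Set.Ico (n : ℝ) (n + 1)).indicator (fun _ => K n) y := by
    intro y hy
    have hi : ∀ n : ℕ, (Set.Ico (n : ℝ) (n + 1)).indicator (fun _ => K n) y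
        = if n = ⌊y⌋₊ then K n else 0 := by
      intro n
      rw [Set.indicator_apply]
      refine if_congr ?_ rfl rfl
      rw [eq_comm, Nat.floor_eq_iff hy, Set.mem_Ico]
    rw [Finset.sum_congr rfl fun n _ => hi n, Finset.sum_ite_eq']
    split_ifs with h
    · rfl
    · exact hK _ (by simpa using h)
  rw [← integral_Ici_eq_integral_Ioi, setIntegral_congr_fun measurableSet_Ici hs,
    integral_finsetSum]
  · rw [tsum_eq_sum (s := Finset.range N) (fun n hn => hK n (by simpa using hn))]
    refine Finset.sum_congr rfl fun n _ => ?_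
    have hsub : Set.Ici (0 : ℝ) ∩ Set.Ico (n : ℝ) (n + 1) = Set.Ico (n : ℝ) (n + 1) :=
      Set.inter_eq_right.2 fun x hx => (Nat.cast_nonneg n).trans hx.1
    rw [setIntegral_indicator measurableSet_Ico, hsub, setIntegral_const]
    simp
  · intro n _
    refine (IntegrableOn.integrable_indicator ?_ measurableSet_Ico).integrableOn
    exact integrableOn_const (by simp)

/-- The sum is the integral of a step function; after the substitution `y = x t²` dominated
convergence applies. Assuming only `|t| → ∞` along `l` covers both signs of `t`. -/
theorem tendsto_inv_sq_mul_tsum {l : Filter ℝ} [l.IsCountablyGenerated]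
    (hl : Tendsto (fun t : ℝ => |t|) l atTop) {K : ℝ → ℕ → ℂ} {k : ℝ → ℂ} {C M : ℝ}
    (hsupp : ∀ t, ∀ n : ℕ, M * t ^ 2 < n → K t n = 0)
    (hbound : ∀ᶠ t in l, ∀ n, ‖K t n‖ ≤ C)
    (hlim : ∀ x, 0 < x → Tendsto (fun t => K t ⌊x * t ^ 2⌋₊) l (𝓝 (k x))) :
    Tendsto (fun t => ((t ^ 2)⁻¹ : ℝ) * ∑' n, K t n) l (𝓝 (∫ x in Set.Ioi (0 : ℝ), k x)) := by
  have hone : ∀ᶠ t in l, 1 ≤ |t| := hl.eventually_ge_atTop 1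
  have h : ∀ᶠ t in l, ∫ x in Set.Ioi (0 : ℝ), K t ⌊x * t ^ 2⌋₊
      = ((t ^ 2)⁻¹ : ℝ) * ∑' n, K t n := by
    filter_upwards [hone] with t ht
    have ht2 : 0 < t ^ 2 := by rw [← sq_abs]; positivity
    rw [integral_comp_mul_right_Ioi (fun y => K t ⌊y⌋₊) 0 ht2, zero_mul,
      integral_comp_floor (K t) (⌊M * t ^ 2⌋₊ + 1), Complex.real_smul]
    intro n hn
    exact hsupp t n (Nat.lt_of_floor_lt (Nat.lt_of_succ_le hn))
  refine Tendsto.congr' h ?_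
  refine tendsto_integral_filter_of_dominated_convergence
    -- The extra `1` absorbs the rounding: if `x > M + 1` and `t² ≥ 1`, then `⌊x t²⌋ > x t² - 1 ≥ M
    -- t²`.
    ((Set.Ioc (0 : ℝ) (M + 1)).indicator fun _ => C) ?_ ?_ ?_ ?_
  · refine Eventually.of_forall fun t => Measurable.aestronglyMeasurable ?_
    exact (measurable_from_nat (f := K t)).comp (Nat.measurable_floor.comp (by fun_prop))
  · filter_upwards [hone, hbound] with t ht hb
    filter_upwards [ae_restrict_mem measurableSet_Ioi] with x hx
    have ht2 : 1 ≤ t ^ 2 := by rw [← sq_abs]; nlinarith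
    rw [Set.indicator_apply]
    split_ifs with hx2
    · exact hb _
    · rw [hsupp t _ ?_, norm_zero]
      have hx3 : M + 1 < x := by
        by_contra hcon
        exact hx2 ⟨hx, not_lt.1 hcon⟩
      have h1 := Nat.sub_one_lt_floor (x * t ^ 2)
      nlinarith
  · refine ((integrableOn_const (by simp)).integrable_indicator measurableSet_Ioc).integrableOn
  · filter_upwards [ae_restrict_mem measurableSet_Ioi] with x hx using hlim x hx

/-! ### Asymptotics of the coherent states -/

/-- Euler's limit for `Γ(p+1)`, since `n! wₙ² = (p+1)ₙ`. The factor `n/(n+p+1)` removes the one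
extra term in the product defining `Real.GammaSeq`. -/
theorem tendsto_normCoeff_mul_rpow {p : ℝ} (hp : -1 < p) :
    Tendsto (fun n : ℕ => normCoeff p n * (n : ℝ) ^ (-(p / 2))) atTop
      (𝓝 (√(Real.Gamma (p + 1))⁻¹)) := by
  have hG := Real.Gamma_pos_of_pos (show 0 < p + 1 by linarith)
  have h1 : Tendsto (fun n : ℕ => (n : ℝ) / (n + (p + 1))) atTop (𝓝 1) :=
    tendsto_natCast_div_add_atTop (p + 1)
  have h2 := h1.mul ((Real.GammaSeq_tendsto_Gamma (p + 1)).inv₀ hG.ne')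
  rw [one_mul] at h2
  have h3 := (Real.continuous_sqrt.tendsto _).comp h2
  refine h3.congr' ?_
  filter_upwards [eventually_ge_atTop 1] with n hn
  have hn0 : (0 : ℝ) < n := by exact_mod_cast hn
  have hw := normCoeff_pos hp n
  simp only [Function.comp_apply]
  rw [Real.sqrt_eq_iff_mul_self_eq]
  · rw [Real.GammaSeq, Finset.prod_range_succ, ← factorial_mul_normCoeff_sq hp n,
      Real.rpow_add hn0, Real.rpow_one]
    have hf : (n.factorial : ℝ) ≠ 0 := by positivity
    have hpn : p + 1 + n ≠ 0 := by linarith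
    have hpn' : (n : ℝ) + (p + 1) ≠ 0 := by linarith
    have e : (n : ℝ) ^ (-(p / 2)) * (n : ℝ) ^ (-(p / 2)) * (n : ℝ) ^ p = 1 := by
      rw [← Real.rpow_add hn0, ← Real.rpow_add hn0]
      ring_nf
      exact Real.rpow_zero _
    have hnp := (Real.rpow_pos_of_pos hn0 p).ne'
    rw [mul_mul_mul_comm, eq_div_of_mul_eq hnp e]
    field_simp
    ring
  · rw [Real.GammaSeq]
    have hprod : 0 < ∏ j ∈ Finset.range (n + 1), (p + 1 + (j : ℝ)) :=
      Finset.prod_pos fun j _ => by have : (0 : ℝ) ≤ j := j.cast_nonneg; linarith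
    have : 0 < (n : ℝ) + (p + 1) := by linarith
    positivity
  · positivity

section Limits

variable {l : Filter ℝ} {σ : ℝ}

/-- `1 / (σ + it)`. -/
def resolvPt (σ t : ℝ) : ℂ := 1 / (σ + Complex.I * t)

theorem ne_zero_of_re_pos (hσ : 0 < σ) (t : ℝ) : (σ : ℂ) + Complex.I * t ≠ 0 := fun h => by
  have := congrArg Complex.re h
  simp at this
  exact hσ.ne' this

theorem norm_mul_resolvPt_le (hσ : 0 < σ) (t : ℝ) : |t| * ‖resolvPt σ t‖ ≤ 1 := by
  rw [resolvPt, norm_div, norm_one, mul_one_div,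
    div_le_one (norm_pos_iff.2 (ne_zero_of_re_pos hσ t))]
  simpa using Complex.abs_im_le_norm ((σ : ℂ) + Complex.I * t)

theorem tendsto_mul_resolvPt (hl : Tendsto (fun t : ℝ => |t|) l atTop) :
    Tendsto (fun t : ℝ => (t : ℂ) * resolvPt σ t) l (𝓝 (-Complex.I)) := by
  have h1 : Tendsto (fun t : ℝ => t⁻¹) l (𝓝 0) := by
    rw [tendsto_zero_iff_norm_tendsto_zero]
    simpa [Function.comp_def] using tendsto_inv_atTop_zero.comp hl
  have h2 : Tendsto (fun t : ℝ => (((σ * t⁻¹ : ℝ) : ℂ) + Complex.I)⁻¹) l (𝓝 (-Complex.I)) := by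
    have h3 := (Complex.continuous_ofReal.tendsto _).comp (h1.const_mul σ)
    rw [mul_zero] at h3
    have h4 := (h3.add_const Complex.I).inv₀ (by simp)
    simpa using h4
  refine h2.congr' ?_
  filter_upwards [hl.eventually_gt_atTop 0] with t ht
  have ht0 : (t : ℂ) ≠ 0 := by simpa using ht
  rw [resolvPt]
  push_cast
  rw [← div_eq_mul_inv, mul_one_div, inv_eq_one_div, show (σ : ℂ) / t + Complex.I
    = (σ + Complex.I * t) / t by field_simp, one_div_div]

theorem tendsto_resolvPt (hl : Tendsto (fun t : ℝ => |t|) l atTop) :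
    Tendsto (resolvPt σ) l (𝓝 0) := by
  have h1 : Tendsto (fun t : ℝ => ((t : ℂ))⁻¹) l (𝓝 0) := by
    rw [tendsto_zero_iff_norm_tendsto_zero]
    simpa [Function.comp_def] using tendsto_inv_atTop_zero.comp hl
  have h2 := h1.mul (tendsto_mul_resolvPt (σ := σ) hl)
  rw [zero_mul] at h2
  refine h2.congr' ?_
  filter_upwards [hl.eventually_gt_atTop 0] with t ht
  have ht0 : (t : ℂ) ≠ 0 := by simpa using ht
  rw [inv_mul_cancel_left₀ ht0]

/-- With `u = 1/(σ+it) = -i/t + σ/t² + O(|t|⁻³)`, expand `log(1-u) = -u - u²/2 + O(|u|³)`. The term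
`-u` contributes `-σ` and `-u²/2` contributes `1/2`. -/
theorem tendsto_sq_mul_log (hσ : 0 < σ) (hl : Tendsto (fun t : ℝ => |t|) l atTop) :
    Tendsto (fun t : ℝ => (t : ℂ) ^ 2 * (Complex.log (1 - resolvPt σ t) - Complex.I / t)) l
      (𝓝 (-((σ - 1 / 2 : ℝ) : ℂ))) := by
  have hv := tendsto_mul_resolvPt (σ := σ) hl
  have hu := tendsto_resolvPt (σ := σ) hl
  have h1 : Tendsto (fun t : ℝ => (t : ℂ) ^ 2 * (Complex.log (1 - resolvPt σ t)
      + resolvPt σ t + resolvPt σ t ^ 2 / 2)) l (𝓝 0) := by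
    have hb : Tendsto (fun t : ℝ => ‖(t : ℂ) * resolvPt σ t‖ ^ 2 * ‖resolvPt σ t‖
        * (1 - ‖resolvPt σ t‖)⁻¹ / 3) l (𝓝 0) := by
      have hn : Tendsto (fun t => ‖resolvPt σ t‖) l (𝓝 0) := by simpa using hu.norm
      have hn2 := (hn.const_sub 1).inv₀ (by norm_num)
      have := ((((hv.norm).pow 2).mul hn).mul hn2).div_const 3
      simpa using this
    refine squeeze_zero_norm' ?_ hb
    have hlt : ∀ᶠ t in l, ‖resolvPt σ t‖ < 1 := by
      have hn : Tendsto (fun t => ‖resolvPt σ t‖) l (𝓝 0) := by simpa using hu.norm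
      exact hn.eventually_lt_const one_pos
    filter_upwards [hlt] with t ht
    have h := Complex.norm_log_sub_logTaylor_le 2 (z := -resolvPt σ t) (by simpa using ht)
    have ht : Complex.logTaylor (2 + 1) (-resolvPt σ t)
        = -resolvPt σ t - resolvPt σ t ^ 2 / 2 := by
      simp [Complex.logTaylor, Finset.sum_range_succ]
      ring
    rw [ht, norm_neg, ← sub_eq_add_neg] at h
    rw [norm_mul, norm_pow]
    have e : Complex.log (1 - resolvPt σ t) + resolvPt σ t + resolvPt σ t ^ 2 / 2
        = Complex.log (1 - resolvPt σ t) - (-resolvPt σ t - resolvPt σ t ^ 2 / 2) := by ring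
    rw [e]
    refine (mul_le_mul_of_nonneg_left h (by positivity)).trans (le_of_eq ?_)
    rw [norm_mul]
    push_cast
    ring
  -- From `u (σ + it) = 1` follows the exact identity `t² (-u - i/t) = -iσ (t u)`, so the divergent
  -- terms cancel without a further expansion.
  have h2 : Tendsto (fun t : ℝ => -Complex.I * σ * ((t : ℂ) * resolvPt σ t)) l
      (𝓝 (-Complex.I * σ * (-Complex.I))) := hv.const_mul _
  have h3 := (hv.pow 2).div_const 2
  have h4 := (h1.add h2).sub h3
  have e : 0 + -Complex.I * σ * (-Complex.I) - (-Complex.I) ^ 2 / 2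
      = -((σ - 1 / 2 : ℝ) : ℂ) := by
    push_cast
    linear_combination ((σ : ℂ) - 1 / 2) * Complex.I_mul_I
  rw [e] at h4
  refine h4.congr' ?_
  filter_upwards [hl.eventually_gt_atTop 0] with t ht
  have ht0 : (t : ℂ) ≠ 0 := by simpa using ht
  have hr : resolvPt σ t * (σ + Complex.I * t) = 1 := by
    rw [resolvPt, one_div, inv_mul_cancel₀ (ne_zero_of_re_pos hσ t)]
  have hI : (t : ℂ) ^ 2 * (Complex.I / t) = Complex.I * t := by field_simp
  rw [mul_sub, hI]
  linear_combination (-Complex.I * t) * hr + (t ^ 2 * resolvPt σ t) * Complex.I_mul_I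

theorem tendsto_phase (hσ : 1 / 2 < σ) (hl : Tendsto (fun t : ℝ => |t|) l atTop) {N : ℝ → ℕ}
    {x : ℝ} (hN : Tendsto (fun t => (N t : ℝ) / t ^ 2) l (𝓝 x)) :
    Tendsto (fun t : ℝ => Complex.exp (-(Complex.I * ((N t / t : ℝ) : ℂ)))
      * (1 - resolvPt σ t) ^ N t) l (𝓝 (Complex.exp (-((σ - 1 / 2) * x : ℝ)))) := by
  have h1 := ((Complex.continuous_ofReal.tendsto _).comp hN).mul
    (tendsto_sq_mul_log (σ := σ) (by linarith) hl)
  have h2 := (Complex.continuous_exp.tendsto _).comp h1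
  have e : (x : ℂ) * -((σ - 1 / 2 : ℝ) : ℂ) = ((-((σ - 1 / 2) * x) : ℝ) : ℂ) := by
    push_cast
    ring
  rw [e] at h2
  have hne : ∀ᶠ t in l, ‖resolvPt σ t‖ < 1 := by
    have hn : Tendsto (fun t => ‖resolvPt σ t‖) l (𝓝 0) := by
      simpa using (tendsto_resolvPt (σ := σ) hl).norm
    exact hn.eventually_lt_const one_pos
  push_cast at h2 ⊢
  refine h2.congr' ?_
  filter_upwards [hl.eventually_gt_atTop 0, hne] with t ht hlt
  have ht0 : (t : ℂ) ≠ 0 := by simpa using ht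
  have hu : 1 - resolvPt σ t ≠ 0 := by
    intro h
    rw [← sub_eq_zero.1 h] at hlt
    simp at hlt
  simp only [Function.comp_apply]
  rw [← Complex.exp_log hu, ← Complex.exp_nat_mul, ← Complex.exp_add, Complex.exp_log hu]
  congr 1
  push_cast
  field_simp
  ring

/-- A positive factor does not change the argument, so no branch jump occurs. -/
theorem rpow_mul_cpow {t : ℝ} (ht : t ≠ 0) {z : ℂ} (hz : z ≠ 0) (a : ℝ) :
    ((|t| ^ a : ℝ) : ℂ) * z ^ (a : ℂ) = ((|t| : ℝ) * z) ^ (a : ℂ) := by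
  have h : 0 < |t| := abs_pos.2 ht
  have h' : ((|t| : ℝ) : ℂ) ≠ 0 := Complex.ofReal_ne_zero.2 h.ne'
  rw [Complex.ofReal_cpow h.le, Complex.cpow_def_of_ne_zero h', Complex.cpow_def_of_ne_zero hz,
    Complex.cpow_def_of_ne_zero (mul_ne_zero h' hz), Complex.log_ofReal_mul h hz, ← Complex.exp_add,
    Complex.ofReal_log h.le]
  congr 1
  ring

/-- The source of the constant phase: `|t|/(σ+it)` tends to `-i` here and to `i` as `t → -∞`, both
off the branch cut of the principal power. -/
theorem tendsto_rpow_mul_cpow_atTop (hσ : 0 < σ) (a : ℝ) :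
    Tendsto (fun t : ℝ => ((|t| ^ a : ℝ) : ℂ) * resolvPt σ t ^ (a : ℂ)) atTop
      (𝓝 (Complex.exp (-(Complex.I * (a * Real.pi / 2))))) := by
  have h := (tendsto_mul_resolvPt (σ := σ) tendsto_abs_atTop_atTop).cpow
    (tendsto_const_nhds (x := (a : ℂ))) (by simp [Complex.mem_slitPlane_iff])
  have e : (-Complex.I) ^ (a : ℂ) = Complex.exp (-(Complex.I * (a * Real.pi / 2))) := by
    rw [Complex.cpow_def_of_ne_zero (by simp), Complex.log_neg_I]
    congr 1
    ring
  rw [e] at h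
  refine h.congr' ?_
  filter_upwards [eventually_gt_atTop 0] with t ht
  rw [rpow_mul_cpow (z := resolvPt σ t) ht.ne' (one_div_ne_zero (ne_zero_of_re_pos hσ t)),
    abs_of_pos ht]

theorem tendsto_rpow_mul_cpow_atBot (hσ : 0 < σ) (a : ℝ) :
    Tendsto (fun t : ℝ => ((|t| ^ a : ℝ) : ℂ) * resolvPt σ t ^ (a : ℂ)) atBot
      (𝓝 (Complex.exp (Complex.I * (a * Real.pi / 2)))) := by
  have h := ((tendsto_mul_resolvPt (σ := σ) tendsto_abs_atBot_atTop).neg).cpow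
    (tendsto_const_nhds (x := (a : ℂ))) (by simp [Complex.mem_slitPlane_iff])
  have e : (-(-Complex.I)) ^ (a : ℂ) = Complex.exp (Complex.I * (a * Real.pi / 2)) := by
    rw [neg_neg, Complex.cpow_def_of_ne_zero (by simp), Complex.log_I]
    congr 1
    ring
  rw [e] at h
  refine h.congr' ?_
  filter_upwards [eventually_lt_atBot 0] with t ht
  rw [rpow_mul_cpow (z := resolvPt σ t) ht.ne (one_div_ne_zero (ne_zero_of_re_pos hσ t)),
    abs_of_neg ht]
  push_cast
  rw [neg_mul]

end Limits

/-- The coherent state `σ + it` with the oscillating factors of `U(t)` removed. -/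
def scaledState (p σ t : ℝ) (n : ℕ) : ℂ :=
  ((|t| : ℝ) : ℂ) * ((-1) ^ n * Complex.exp (-(Complex.I * ((n / t : ℝ) : ℂ)))
    * coherentSeq p (σ + Complex.I * t) n)

/-- The factorization isolates pieces with separate limits at `n ≈ x t²`: the constant phase, the
Gamma constant, `x^{p/2}` and the exponential. The powers of `|t|` and `n` balance to the single
`|t|` in front. -/
theorem scaledState_eq (p σ : ℝ) {t : ℝ} (ht : t ≠ 0) {n : ℕ} (hn : n ≠ 0) :
    scaledState p σ t n
      = ((|t| ^ (p + 1) : ℝ) : ℂ) * resolvPt σ t ^ ((p + 1 : ℝ) : ℂ)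
        * ((normCoeff p n * (n : ℝ) ^ (-(p / 2)) : ℝ) : ℂ) * (((n / t ^ 2) ^ (p / 2) : ℝ) : ℂ)
        * (Complex.exp (-(Complex.I * ((n / t : ℝ) : ℂ))) * (1 - resolvPt σ t) ^ n) := by
  have hn0 : (0 : ℝ) < n := by positivity
  have ht0 : 0 < |t| := abs_pos.2 ht
  have e1 : |t| ^ (p + 1) * (normCoeff p n * (n : ℝ) ^ (-(p / 2))) * (n / t ^ 2) ^ (p / 2)
      = |t| * normCoeff p n := by
    rw [← sq_abs, Real.div_rpow hn0.le (by positivity), ← Real.rpow_natCast, ← Real.rpow_mul ht0.le,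
      Real.rpow_neg hn0.le, Real.rpow_add ht0, Real.rpow_one]
    have h1 := (Real.rpow_pos_of_pos hn0 (p / 2)).ne'
    have h2 := (Real.rpow_pos_of_pos ht0 p).ne'
    have h3 : ((2 : ℕ) : ℝ) * (p / 2) = p := by push_cast; ring
    rw [h3]
    field_simp
  have e2 : (-1 : ℂ) ^ n * (1 / (σ + Complex.I * t) - 1) ^ n = (1 - resolvPt σ t) ^ n := by
    rw [← mul_pow, resolvPt]
    congr 1
    ring
  have e1' := congrArg (fun x : ℝ => (x : ℂ)) e1
  simp only [Complex.ofReal_mul] at e1'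
  rw [scaledState, coherentSeq, ← e2, Complex.ofReal_mul]
  rw [show (1 / ((σ : ℂ) + Complex.I * t)) = resolvPt σ t from rfl]
  linear_combination -(resolvPt σ t ^ ((p + 1 : ℝ) : ℂ) * (-1) ^ n * (resolvPt σ t - 1) ^ n
    * Complex.exp (-(Complex.I * ((n / t : ℝ) : ℂ)))) * e1'

theorem tendsto_floor_div {l : Filter ℝ} (hl : Tendsto (fun t : ℝ => |t|) l atTop) {x : ℝ}
    (hx : 0 < x) : Tendsto (fun t : ℝ => (⌊x * t ^ 2⌋₊ : ℝ) / t ^ 2) l (𝓝 x) ∧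
      Tendsto (fun t : ℝ => ⌊x * t ^ 2⌋₊) l atTop := by
  have h2 : Tendsto (fun t : ℝ => t ^ 2) l atTop := by
    simpa [Function.comp_def] using (tendsto_pow_atTop two_ne_zero).comp hl
  have h3 := (tendsto_nat_floor_mul_div_atTop (R := ℝ) hx.le).comp h2
  have h4 := (tendsto_nat_floor_atTop (α := ℝ)).comp (h2.const_mul_atTop hx)
  exact ⟨h3, h4⟩

theorem tendsto_scaledState {p σ : ℝ} (hp : -1 < p) (hσ : 1 / 2 < σ) {l : Filter ℝ}
    (hl : Tendsto (fun t : ℝ => |t|) l atTop) {c : ℂ}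
    (hc : Tendsto (fun t : ℝ => ((|t| ^ (p + 1) : ℝ) : ℂ) * resolvPt σ t ^ ((p + 1 : ℝ) : ℂ)) l
      (𝓝 c)) {x : ℝ} (hx : 0 < x) :
    Tendsto (fun t => scaledState p σ t ⌊x * t ^ 2⌋₊) l (𝓝 (c * coherentFun p σ x)) := by
  obtain ⟨hN, hN'⟩ := tendsto_floor_div hl hx
  have h1 := (Complex.continuous_ofReal.tendsto _).comp ((tendsto_normCoeff_mul_rpow hp).comp hN')
  have h2 := (Complex.continuous_ofReal.tendsto _).comp
    ((Real.continuousAt_rpow_const x (p / 2) (Or.inl hx.ne')).tendsto.comp hN)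
  have h3 := tendsto_phase hσ hl hN
  have h := ((hc.mul h1).mul h2).mul h3
  -- The root of the weight carries `e^{-x/2}`, which accounts for the difference between `σ - 1/2`
  -- and `σ - 1`.
  have e : c * ((√(Real.Gamma (p + 1))⁻¹ : ℝ) : ℂ) * ((x ^ (p / 2) : ℝ) : ℂ)
      * Complex.exp (-((σ - 1 / 2) * x : ℝ)) = c * coherentFun p σ x := by
    have hw : √(weight p x) = √(Real.Gamma (p + 1))⁻¹ * x ^ (p / 2) * Real.exp (-x / 2) := by
      have hG := Real.Gamma_pos_of_pos (show 0 < p + 1 by linarith)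
      rw [weight, Real.sqrt_mul (by positivity), Real.sqrt_mul (by positivity),
        Real.sqrt_eq_rpow (x ^ p), ← Real.rpow_mul hx.le, Real.exp_half]
      congr 3
      ring
    have hexp : Complex.exp (-((σ - 1 / 2) * x : ℝ))
        = Complex.exp ((-x / 2 : ℝ)) * Complex.exp (-((σ - 1) * x)) := by
      rw [← Complex.exp_add]
      congr 1
      push_cast
      ring
    rw [coherentFun, hw, hexp, Complex.ofReal_mul, Complex.ofReal_mul, Complex.ofReal_exp]
    ring
  rw [e] at h
  refine h.congr' ?_
  filter_upwards [hl.eventually_gt_atTop 0, hN'.eventually_gt_atTop 0] with t ht hn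
  rw [scaledState_eq p σ (abs_pos.1 ht) hn.ne']
  rfl

/-- Domination for the Riemann sums: `|t|/|σ+it| ≤ 1`, `|1 - 1/(σ+it)| ≤ 1`, and the convergent
sequence `wₙ n^{-p/2}` is bounded. -/
theorem norm_scaledState_le {p : ℝ} (hp : -1 < p) : ∃ C : ℝ, 0 ≤ C ∧
    ∀ (σ t : ℝ) (n : ℕ), 1 / 2 < σ → t ≠ 0 → n ≠ 0 →
      ‖scaledState p σ t n‖ ≤ C * (n / t ^ 2) ^ (p / 2) := by
  obtain ⟨C, hC⟩ := (tendsto_normCoeff_mul_rpow hp).bddAbove_range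
  have hC0 : ∀ n, 0 ≤ normCoeff p n * (n : ℝ) ^ (-(p / 2)) := fun n =>
    mul_nonneg (normCoeff_pos hp n).le (Real.rpow_nonneg n.cast_nonneg _)
  refine ⟨C, (hC0 0).trans (hC ⟨0, rfl⟩), fun σ t n hσ ht hn => ?_⟩
  have hr : (0 : ℝ) ≤ (n / t ^ 2) ^ (p / 2) := by positivity
  have h1 : ‖((|t| ^ (p + 1) : ℝ) : ℂ) * resolvPt σ t ^ ((p + 1 : ℝ) : ℂ)‖ ≤ 1 := by
    rw [norm_mul, Complex.norm_cpow_real, Complex.norm_real, Real.norm_of_nonneg (by positivity),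
      ← Real.mul_rpow (abs_nonneg t) (norm_nonneg _)]
    exact Real.rpow_le_one (by positivity) (norm_mul_resolvPt_le (by linarith) t) (by linarith)
  have h2 : ‖1 - resolvPt σ t‖ ≤ 1 := by
    rw [norm_sub_rev]
    exact (norm_one_div_sub_one_lt (s := σ + Complex.I * t) (by simpa using hσ)).le
  rw [scaledState_eq p σ ht hn, norm_mul, norm_mul, norm_mul, norm_mul (Complex.exp _), norm_pow,
    Complex.norm_real, Complex.norm_real, Real.norm_of_nonneg (hC0 n), Real.norm_of_nonneg hr]
  have h3 : ‖Complex.exp (-(Complex.I * ((n / t : ℝ) : ℂ)))‖ = 1 := by simp [Complex.norm_exp]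
  rw [h3, one_mul]
  have h4 := hC ⟨n, rfl⟩
  calc _ ≤ 1 * C * (n / t ^ 2) ^ (p / 2) * 1 := by
        have hC1 : 0 ≤ C := (hC0 0).trans (hC ⟨0, rfl⟩)
        gcongr
        · exact hC0 n
        · exact pow_le_one₀ (norm_nonneg _) h2
    _ = _ := by ring

/-- The power may blow up at zero when `p < 0`, but the support of `g` is a compact subset of `(0,
∞)`. The product is what remains after the bound on the scaled coherent states. -/
theorem exists_testFunction_bound (p : ℝ) (g : 𝓓(posReals, ℂ)) :
    ∃ B : ℝ, ∀ y, ‖((y ^ (p / 2) : ℝ) : ℂ) * g y‖ ≤ B := by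
  have hcont : ContinuousOn (fun y => ((y ^ (p / 2) : ℝ) : ℂ) * g y) (tsupport g) := by
    refine ContinuousOn.mul (Complex.continuous_ofReal.comp_continuousOn fun y hy => ?_)
      g.continuous.continuousOn
    have hy0 : 0 < y := g.tsupport_subset hy
    exact (Real.continuousAt_rpow_const y (p / 2) (Or.inl hy0.ne')).continuousWithinAt
  obtain ⟨B, hB⟩ := g.hasCompactSupport.isCompact.exists_bound_of_continuousOn hcont
  refine ⟨max B 0, fun y => ?_⟩
  by_cases hy : y ∈ tsupport g
  · exact (hB y hy).trans (le_max_left _ _)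
  · rw [image_eq_zero_of_notMem_tsupport hy]
    simp

theorem exists_testFunction_support (g : 𝓓(posReals, ℂ)) :
    ∃ M : ℝ, ∀ y, M < y → g y = 0 := by
  obtain ⟨M, hM⟩ := g.hasCompactSupport.isCompact.bddAbove
  exact ⟨M, fun y hy => image_eq_zero_of_notMem_tsupport fun h => absurd (hM h) (not_le.2 hy)⟩

theorem testFunction_zero (g : 𝓓(posReals, ℂ)) : g 0 = 0 :=
  image_eq_zero_of_notMem_tsupport fun h => lt_irrefl (0 : ℝ) (g.tsupport_subset h)

theorem tendsto_testFunction_floor (g : 𝓓(posReals, ℂ)) {l : Filter ℝ}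
    (hl : Tendsto (fun t : ℝ => |t|) l atTop) {x : ℝ} (hx : 0 < x) :
    Tendsto (fun t : ℝ => g ((⌊x * t ^ 2⌋₊ : ℝ) / t ^ 2)) l (𝓝 (g x)) :=
  (g.continuous.tendsto x).comp (tendsto_floor_div hl hx).1

theorem asympEvolution_apply (t : ℝ) (g : 𝓓(posReals, ℂ)) (n : ℕ) :
    asympEvolution t g n = asympSeq t g n := rfl

theorem norm_asympSeq (t : ℝ) (g : ℝ → ℂ) (n : ℕ) :
    ‖asympSeq t g n‖ = |t|⁻¹ * ‖g (n / t ^ 2)‖ := by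
  simp [asympSeq, Complex.norm_exp]

/-- The operators `U(t)` are asymptotically isometric. -/
theorem tendsto_norm_sq_asympEvolution {p : ℝ} (hp : -1 < p) (f : SeqSpace) (g : 𝓓(posReals, ℂ))
    (hfg : (Phi p hp f : ℝ → ℂ) =ᵐ[halfLine] (g : ℝ → ℂ)) {l : Filter ℝ} [l.IsCountablyGenerated]
    (hl : Tendsto (fun t : ℝ => |t|) l atTop) :
    Tendsto (fun t => ‖asympEvolution t g‖ ^ 2) l (𝓝 (‖f‖ ^ 2)) := by
  obtain ⟨M, hM⟩ := exists_testFunction_support g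
  obtain ⟨B, hB⟩ := exists_testFunction_bound 0 g
  have hB' : ∀ y, ‖g y‖ ≤ B := fun y => by simpa using hB y
  have h := tendsto_inv_sq_mul_tsum hl (M := M) (C := B ^ 2)
    -- The support condition is required for every `t`, so the degenerate quotient at `t = 0` is
    -- replaced by zero.
    (K := fun t n => if t = 0 then 0 else ((‖g (n / t ^ 2)‖ ^ 2 : ℝ) : ℂ))
    (k := fun x => ((‖g x‖ ^ 2 : ℝ) : ℂ)) ?_ ?_ ?_
  · rw [integral_complex_ofReal] at h
    have hn : ‖f‖ ^ 2 = ∫ x in Set.Ioi (0 : ℝ), ‖g x‖ ^ 2 := by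
      rw [← (Phi p hp).norm_map, norm_sq_eq_integral]
      refine integral_congr_ae ?_
      filter_upwards [hfg] with x hx
      rw [hx]
    rw [← hn] at h
    have h2 := (Complex.continuous_re.tendsto _).comp h
    rw [Complex.ofReal_re] at h2
    refine h2.congr' ?_
    filter_upwards [hl.eventually_gt_atTop 0] with t ht
    have ht0 : t ≠ 0 := abs_pos.1 ht
    have h3 := lp.hasSum_norm (p := 2) (by simp) (asympEvolution t g)
    simp only [ENNReal.toReal_ofNat, Real.rpow_two, asympEvolution_apply, norm_asympSeq,
      mul_pow, inv_pow, sq_abs] at h3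
    rw [← h3.tsum_eq, tsum_mul_left]
    simp only [Function.comp_apply, ht0, if_false]
    rw [← Complex.ofReal_tsum, ← Complex.ofReal_mul, Complex.ofReal_re]
  · intro t n hn
    by_cases ht : t = 0
    · simp [ht]
    · have ht2 : 0 < t ^ 2 := by positivity
      simp [ht, hM _ ((lt_div_iff₀ ht2).2 hn)]
  · refine Eventually.of_forall fun t n => ?_
    split_ifs
    · simpa using sq_nonneg B
    · rw [Complex.norm_real, Real.norm_of_nonneg (sq_nonneg _)]
      exact pow_le_pow_left₀ (norm_nonneg _) (hB' _) 2
  · intro x hx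
    refine ((Complex.continuous_ofReal.tendsto _).comp
      (((tendsto_testFunction_floor g hl hx).norm).pow 2)).congr' ?_
    filter_upwards [hl.eventually_gt_atTop 0] with t ht
    rw [if_neg (abs_pos.1 ht)]
    rfl

/-- The evolved state is the explicit one with parameter `σ + it`. Its oscillation cancels against
that of `U(t)`, leaving a Riemann sum for `∫ conj(c v) c g = ∫ conj(v) g`, where `v` is the coherent
function. The factor `|t|` put into `scaledState` turns `|t|⁻¹` into the mesh `t⁻²`. -/
theorem tendsto_inner_coherentState {p σ : ℝ} (hp : -1 < p) (hσ : 1 / 2 < (σ : ℂ).re)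
    (f : SeqSpace) (g : 𝓓(posReals, ℂ))
    (hfg : (Phi p hp f : ℝ → ℂ) =ᵐ[halfLine] (g : ℝ → ℂ)) {l : Filter ℝ} [l.IsCountablyGenerated]
    (hl : Tendsto (fun t : ℝ => |t|) l atTop) {c : ℂ} (hc1 : ‖c‖ = 1)
    (hc : Tendsto (fun t : ℝ => ((|t| ^ (p + 1) : ℝ) : ℂ) * resolvPt σ t ^ ((p + 1 : ℝ) : ℂ)) l
      (𝓝 c)) :
    Tendsto (fun t => inner ℂ (laguerreGroup p hp t (coherentState p hp hσ))
      (c • asympEvolution t g)) l (𝓝 (inner ℂ (coherentState p hp hσ) f)) := by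
  have hσ' : 1 / 2 < σ := by simpa using hσ
  obtain ⟨M, hM⟩ := exists_testFunction_support g
  obtain ⟨B, hB⟩ := exists_testFunction_bound p g
  obtain ⟨C, hC0, hC⟩ := norm_scaledState_le hp
  have h := tendsto_inv_sq_mul_tsum hl (M := M) (C := C * B)
    (K := fun t n => (starRingEnd ℂ) (scaledState p σ t n) * (c * g (n / t ^ 2)))
    (k := fun x => (starRingEnd ℂ) (c * coherentFun p σ x) * (c * g x)) ?_ ?_ ?_
  · have hk : ∫ x in Set.Ioi (0 : ℝ), (starRingEnd ℂ) (c * coherentFun p σ x) * (c * g x)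
        = inner ℂ (coherentState p hp hσ) f := by
      rw [← (Phi p hp).inner_map_map, Phi_coherentState, L2.inner_def]
      refine integral_congr_ae ?_
      filter_upwards [hfg, coeFn_coherentVec hp hσ] with x h1 h2
      have hcc : (starRingEnd ℂ) c * c = 1 := by
        rw [Complex.conj_mul', hc1]
        simp
      rw [h1, h2, RCLike.inner_apply, map_mul]
      linear_combination ((starRingEnd ℂ) (coherentFun p σ x) * g x) * hcc
    rw [hk] at h
    refine h.congr' ?_
    filter_upwards [hl.eventually_gt_atTop 0] with t ht
    have ht0 : t ≠ 0 := abs_pos.1 ht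
    have hs' : 1 / 2 < ((σ : ℂ) + Complex.I * t).re := by simpa using hσ'
    rw [laguerreGroup_coherentState hp hσ hs' t rfl, lp.inner_eq_tsum, ← tsum_mul_left]
    refine tsum_congr fun n => ?_
    rw [coherentState_apply, lp.coeFn_smul, Pi.smul_apply, asympEvolution_apply, smul_eq_mul,
      RCLike.inner_apply, asympSeq, scaledState]
    simp only [map_mul, map_pow, map_neg, map_one, Complex.conj_ofReal, ← Complex.exp_conj,
      Complex.conj_I]
    have e : ((t ^ 2)⁻¹ : ℝ) * |t| = |t|⁻¹ := by
      rw [← sq_abs]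
      field_simp
    have e' := congrArg (fun x : ℝ => (x : ℂ)) e
    simp only [Complex.ofReal_mul] at e'
    rw [show -(-Complex.I * ((n / t : ℝ) : ℂ)) = Complex.I * ((n / t : ℝ) : ℂ) by ring, ← e']
    ring
  · intro t n hn
    by_cases ht : t = 0
    · simp [ht, scaledState]
    · have ht2 : 0 < t ^ 2 := by positivity
      simp [hM _ ((lt_div_iff₀ ht2).2 hn)]
  · filter_upwards [hl.eventually_gt_atTop 0] with t ht n
    have ht0 : t ≠ 0 := abs_pos.1 ht
    have hB0 : 0 ≤ B := (norm_nonneg _).trans (hB 0)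
    -- The bound on the scaled state excludes `n = 0`, where instead `g 0 = 0`.
    rcases eq_or_ne n 0 with rfl | hn
    · simp [testFunction_zero]
      positivity
    · rw [norm_mul, norm_mul, hc1, one_mul, RCLike.norm_conj]
      refine (mul_le_mul_of_nonneg_right (hC σ t n hσ' ht0 hn) (norm_nonneg _)).trans ?_
      rw [mul_assoc]
      refine mul_le_mul_of_nonneg_left ?_ hC0
      have := hB (n / t ^ 2)
      rwa [norm_mul, Complex.norm_real, Real.norm_of_nonneg (by positivity)] at this
  · intro x hx
    exact ((Complex.continuous_conj.tendsto _).comp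
      (tendsto_scaledState hp hσ' hl hc hx)).mul
      ((tendsto_testFunction_floor g hl hx).const_mul c)

/-- A bounded family that converges weakly against a total set converges weakly. -/
theorem tendsto_inner_of_total {H ι : Type*} [NormedAddCommGroup H] [InnerProductSpace ℂ H]
    [CompleteSpace H] {l : Filter ι} {W : ι → H} {z : H} {C : ℝ} (hC : ∀ᶠ t in l, ‖W t‖ ≤ C)
    (D : Set H) (hD : ∀ u : H, (∀ f ∈ D, inner ℂ u f = 0) → u = 0)
    (h : ∀ f ∈ D, Tendsto (fun t => inner ℂ f (W t)) l (𝓝 (inner ℂ f z))) (f : H) :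
    Tendsto (fun t => inner ℂ f (W t)) l (𝓝 (inner ℂ f z)) := by
  have hspan : ∀ f ∈ Submodule.span ℂ D,
      Tendsto (fun t => inner ℂ f (W t)) l (𝓝 (inner ℂ f z)) := by
    intro f hf
    induction hf using Submodule.span_induction with
    | mem x hx => exact h x hx
    | zero => simpa only [inner_zero_left] using tendsto_const_nhds
    | add x y _ _ hx hy => simpa only [inner_add_left] using hx.add hy
    | smul a x _ hx => simpa only [inner_smul_left] using hx.const_mul _
  have hdense : (Submodule.span ℂ D).topologicalClosure = ⊤ := by
    rw [Submodule.topologicalClosure_eq_top_iff, Submodule.eq_bot_iff]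
    intro u hu
    rw [Submodule.mem_orthogonal'] at hu
    exact hD u fun f hf => hu f (Submodule.subset_span hf)
  rw [Metric.tendsto_nhds]
  intro ε hε
  set R := |C| + ‖z‖ + 1 with hR
  have hR0 : 0 < R := by positivity
  have hf : f ∈ closure (Submodule.span ℂ D : Set H) := by
    rw [← Submodule.topologicalClosure_coe, hdense]
    trivial
  obtain ⟨f', hf', hff⟩ := Metric.mem_closure_iff.1 hf (ε / (2 * R)) (by positivity)
  rw [dist_eq_norm] at hff
  filter_upwards [hC, Metric.tendsto_nhds.1 (hspan f' hf') (ε / 2) (by positivity)] with t ht hd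
  rw [dist_eq_norm] at hd ⊢
  have e : (inner ℂ f (W t) - inner ℂ f z : ℂ)
      = inner ℂ (f - f') (W t - z) + (inner ℂ f' (W t) - inner ℂ f' z) := by
    simp only [inner_sub_left, inner_sub_right]
    ring
  have h1 := norm_inner_le_norm (𝕜 := ℂ) (f - f') (W t - z)
  have h2 : ‖W t - z‖ ≤ R := by
    have := norm_sub_le (W t) z
    have := le_abs_self C
    linarith
  have h3 : ‖f - f'‖ * ‖W t - z‖ ≤ ε / 2 := by
    calc ‖f - f'‖ * ‖W t - z‖ ≤ ε / (2 * R) * R :=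
          mul_le_mul hff.le h2 (norm_nonneg _) (by positivity)
      _ = ε / 2 := by field_simp
  rw [e]
  exact (norm_add_le _ _).trans_lt (by linarith)

theorem tendsto_norm_sub_zero_of_inner {H ι : Type*} [NormedAddCommGroup H]
    [InnerProductSpace ℂ H] {l : Filter ι} {W : ι → H} {z : H}
    (hn : Tendsto (fun t => ‖W t‖ ^ 2) l (𝓝 (‖z‖ ^ 2)))
    (hi : Tendsto (fun t => inner ℂ z (W t)) l (𝓝 (inner ℂ z z))) :
    Tendsto (fun t => ‖z - W t‖) l (𝓝 0) := by
  have h1 := (Complex.continuous_re.tendsto _).comp hi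
  have h2 : (inner ℂ z z : ℂ).re = ‖z‖ ^ 2 := inner_self_eq_norm_sq (𝕜 := ℂ) z
  rw [h2] at h1
  have h3 : Tendsto (fun t => ‖z - W t‖ ^ 2) l (𝓝 0) := by
    have h4 := ((h1.const_mul 2).const_sub (‖z‖ ^ 2)).add hn
    have e : ‖z‖ ^ 2 - 2 * ‖z‖ ^ 2 + ‖z‖ ^ 2 = 0 := by ring
    rw [e] at h4
    refine h4.congr fun t => ?_
    rw [@norm_sub_sq ℂ]
    rfl
  have h5 := (Real.continuous_sqrt.tendsto _).comp h3
  simpa [Function.comp_def] using h5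

/-- Undoing the evolution gives `W(t) = V(t)⁻¹ c U(t) g`, to be compared with the fixed vector `f`.
Its norms converge to `‖f‖`, and pairings with the total set of coherent states give weak
convergence to `f`; together these give norm convergence. -/
theorem tendsto_norm_laguerreGroup_sub {p : ℝ} (hp : -1 < p) (f : SeqSpace) (g : 𝓓(posReals, ℂ))
    (hfg : (Phi p hp f : ℝ → ℂ) =ᵐ[halfLine] (g : ℝ → ℂ)) {l : Filter ℝ} [l.IsCountablyGenerated]
    (hl : Tendsto (fun t : ℝ => |t|) l atTop) {c : ℂ} (hc1 : ‖c‖ = 1)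
    (hc : ∀ σ : ℝ, 0 < σ → Tendsto (fun t : ℝ => ((|t| ^ (p + 1) : ℝ) : ℂ)
      * resolvPt σ t ^ ((p + 1 : ℝ) : ℂ)) l (𝓝 c)) :
    Tendsto (fun t => ‖laguerreGroup p hp t f - c • asympEvolution t g‖) l (𝓝 0) := by
  set W : ℝ → SeqSpace := fun t => (laguerreGroup p hp t).symm (c • asympEvolution t g) with hW
  have hWi : ∀ (u : SeqSpace) (t : ℝ), inner ℂ u (W t)
      = inner ℂ (laguerreGroup p hp t u) (c • asympEvolution t g) := fun u t => by
    rw [← (laguerreGroup p hp t).inner_map_map u, LinearIsometryEquiv.apply_symm_apply]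
  have hWn : ∀ t, ‖W t‖ = ‖asympEvolution t g‖ := fun t => by
    rw [hW, LinearIsometryEquiv.norm_map, norm_smul, hc1, one_mul]
  have hn : Tendsto (fun t => ‖W t‖ ^ 2) l (𝓝 (‖f‖ ^ 2)) := by
    simpa only [hWn] using tendsto_norm_sq_asympEvolution hp f g hfg hl
  have hbd : ∀ᶠ t in l, ‖W t‖ ≤ ‖f‖ + 1 := by
    filter_upwards [hn.eventually_lt_const (show ‖f‖ ^ 2 < (‖f‖ + 1) ^ 2 by
      nlinarith [norm_nonneg f])] with t ht
    exact ((sq_lt_sq₀ (norm_nonneg _) (by positivity)).1 ht).le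
  have hi := tendsto_inner_of_total (z := f) hbd
    {u | ∃ (σ : ℝ) (hσ : 1 / 2 < (σ : ℂ).re), u = coherentState p hp hσ}
    (fun u hu => eq_zero_of_inner_coherentState hp u fun s hs => hu _ ⟨s, hs, rfl⟩)
    (by
      rintro _ ⟨σ, hσ, rfl⟩
      have hσ0 : 0 < σ := by
        have : 1 / 2 < σ := by simpa using hσ
        linarith
      simpa only [hWi] using tendsto_inner_coherentState hp hσ f g hfg hl hc1 (hc σ hσ0)) f
  refine (tendsto_norm_sub_zero_of_inner hn hi).congr fun t => ?_
  rw [← (laguerreGroup p hp t).norm_map, map_sub, LinearIsometryEquiv.apply_symm_apply]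

end

end Laguerre

theorem theorem5 (p : ℝ) (hp : -1 < p) :
    (∃! V : ℝ → (Laguerre.SeqSpace ≃ₗᵢ[ℂ] Laguerre.SeqSpace),
      Laguerre.IsUnitaryGroup (Laguerre.laguerreOperator p) V) ∧
    ∀ (f : Laguerre.SeqSpace) (g : 𝓓(Laguerre.posReals, ℂ)),
      (Laguerre.Phi p hp f : ℝ → ℂ) =ᵐ[Laguerre.halfLine] (g : ℝ → ℂ) →
      Tendsto (fun t : ℝ => ‖Laguerre.unitaryGroup (Laguerre.laguerreOperator p) t f
          - Complex.exp (-(Complex.I * ((p + 1) * Real.pi / 2))) •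
            Laguerre.asympEvolution t g‖) atTop (𝓝 0) ∧
      Tendsto (fun t : ℝ => ‖Laguerre.unitaryGroup (Laguerre.laguerreOperator p) t f
          - Complex.exp (Complex.I * ((p + 1) * Real.pi / 2)) •
            Laguerre.asympEvolution t g‖) atBot (𝓝 0) := by
  refine ⟨⟨Laguerre.laguerreGroup p hp, Laguerre.isUnitaryGroup_laguerreGroup p hp, fun W hW =>
    hW.unique (Laguerre.dense_domain_laguerreOperator p)
      (Laguerre.isUnitaryGroup_laguerreGroup p hp)⟩, fun f g hfg => ?_⟩
  rw [Laguerre.unitaryGroup_laguerreOperator p hp]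
  have e : ((p + 1 : ℝ) : ℂ) = (p : ℂ) + 1 := by push_cast; rfl
  constructor
  -- The two time directions differ only in the limit of `|t|^{p+1} (σ+it)^{-p-1}`.
  · refine Laguerre.tendsto_norm_laguerreGroup_sub hp f g hfg tendsto_abs_atTop_atTop ?_
      fun σ hσ => ?_
    · simp [Complex.norm_exp]
    · rw [← e]
      exact Laguerre.tendsto_rpow_mul_cpow_atTop hσ (p + 1)
  · refine Laguerre.tendsto_norm_laguerreGroup_sub hp f g hfg tendsto_abs_atBot_atTop ?_
      fun σ hσ => ?_
    · simp [Complex.norm_exp]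
    · rw [← e]
      exact Laguerre.tendsto_rpow_mul_cpow_atBot hσ (p + 1)
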